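/- Let $k=\mathbb F_q$ be a finite field and let $\mathcal C$ be a $k$-linear triangulated category with shift $[1]$ such that: (1) $\operatorname{Hom}(X,Y)$ is a finite-dimensional $k$-space for all $X,Y$; (2) $\operatorname{End}X$ is a local ring for every indecomposable $X$; (3) $\sum_{i\ge 0}\dim_k\operatorname{Hom}(X[i],Y)<\infty$ for all $X,Y$. For objects $X,Y,L$ put $$\{X,Y\}=\prod_{i>0}|\operatorname{Hom}(X[i],Y)|^{(-1)^i}.$$ Let $V(X,Y;L)$ be the set of orbits of $\operatorname{Aut}X\times\operatorname{Aut}Y$ on the set of triples $(f,g,h)$ such that $X\xrightarrow{f}L\xrightarrow{g}Y\xrightarrow{h}X[1]$ is a distinguished triangle, where (composing in the order of the arrows) $(a,c)$ sends $(f,g,h)$ to $(af,\,gc^{-1},\,ch(a[1])^{-1})$. Let $\operatorname{Hom}(X,L)_Y$ be the set of morphisms $X\to L$ whose cone is isomorphic to $Y$. A morphism $n:A\to B$ is called radical if no composite $D\to A\xrightarrow{n}B\to D$ with $D$ indecomposable is an isomorphism. Then the following hold. (a) For every $h:Y\to X[1]$ there are decompositions $Y\cong Y_1\oplus Y_2$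 and $X[1]\cong X_1[1]\oplus X_2[1]$ for which $h$ is the diagonal matrix of an isomorphism $Y_1\to X_1[1]$ and a radical morphism $Y_2\to X_2[1]$, and $X_1$ is unique up to isomorphism. For $\alpha\in V(X,Y;L)$, the class of $(f,g,h)$, write $X_1(\alpha)$ for this $X_1$. (b) The derived Hall number $$F_{XY}^L=\{X,Y\}\sum_{\alpha\in V(X,Y;L)}\frac{|\operatorname{End}X_1(\alpha)|}{|\operatorname{Aut}X_1(\alpha)|}$$ satisfies $$F_{XY}^L=\frac{|\operatorname{Hom}(X,L)_Y|\,\{X,L\}}{|\operatorname{Aut}X|\,\{X,X\}}=\frac{|\operatorname{Hom}(L,Y)_{X[1]}|\,\{L,Y\}}{|\operatorname{Aut}Y|\,\{Y,Y\}}.$$ It depends only on the isomorphism classes of $X,Y,L$, and for fixed $X,Y$ it is nonzero for only finitely many isomorphism classes $[L]$. (c) For all $X,Y,Z,M$, with sums over isomorphism classes of objects, $$\sum_{[L]}F_{XY}^{L}F_{ZL}^{M}=\sum_{[L']}F_{ZX}^{L'}F_{L'Y}^{M}.$$ (d) The $\mathbb Q$-vector space with basis $\{u_{[X]}\}$ indexed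 by the isomorphism classes of objects of $\mathcal C$ is an associative unital $\mathbb Q$-algebra with product $u_{[X]}*u_{[Y]}=\sum_{[L]}F_{XY}^L\,u_{[L]}$ and unit $u_{[0]}$. -/

import Mathlib

open CategoryTheory CategoryTheory.Limits CategoryTheory.Pretriangulated
open scoped ZeroObject

universe w v u

namespace DerivedHall

noncomputable section

section Triangulated

variable {C : Type u} [Category.{v} C] [Preadditive C] [HasZeroObject C] [HasShift C ℤ]
  [∀ n : ℤ, (shiftFunctor C n).Additive] [Pretriangulated C]

/-- The rational number `{X, Y} = ∏_{i > 0} |Hom(X[i], Y)| ^ ((-1) ^ i)`. -/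
def bracket (X Y : C) : ℚ :=
  ∏ᶠ (i : ℕ) (_ : 0 < i), (Nat.card (X⟦(i : ℤ)⟧ ⟶ Y) : ℚ) ^ ((-1 : ℤ) ^ i)

/-- `W(X, Y; L)`: the triples `(f, g, h)` such that `X ⟶ L ⟶ Y ⟶ X[1]` is a
distinguished triangle. -/
@[ext]
structure Tri (X Y L : C) where
  f : X ⟶ L
  g : L ⟶ Y
  h : Y ⟶ X⟦(1 : ℤ)⟧
  dist : Triangle.mk f g h ∈ distTriang C

/-- Two elements of `W(X, Y; L)` are equivalent if they lie in the same orbit of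
`Aut X × Aut Y`, which acts by `(a, c) • (f, g, h) = (a f, g c⁻¹, c h (a[1])⁻¹)`
(compositions written in the order of the arrows). -/
def triSetoid (X Y L : C) : Setoid (Tri X Y L) where
  r s t := ∃ (a : X ≅ X) (c : Y ≅ Y),
    t.f = a.hom ≫ s.f ∧ t.g = s.g ≫ c.inv ∧ t.h = c.hom ≫ s.h ≫ a.inv⟦(1 : ℤ)⟧'
  iseqv :=
    { refl := fun s => ⟨Iso.refl X, Iso.refl Y, by simp, by simp, by simp⟩
      symm := by
        rintro s t ⟨a, c, h₁, h₂, h₃⟩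
        refine ⟨a.symm, c.symm, by simp [h₁], by simp [h₂], ?_⟩
        simp [h₃, ← Functor.map_comp]
      trans := by
        rintro s t r ⟨a, c, h₁, h₂, h₃⟩ ⟨a', c', h₁', h₂', h₃'⟩
        exact ⟨a' ≪≫ a, c' ≪≫ c, by simp [h₁', h₁], by simp [h₂', h₂], by simp [h₃', h₃]⟩ }

/-- The orbit space `V(X, Y; L)`. -/
def TriOrbit (X Y L : C) : Type v := Quotient (triSetoid X Y L)

/-- `f` lies in `rad Hom(X, Y)`: no composite `A ⟶ X ⟶ Y ⟶ A` through `f` with `A`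
indecomposable is an isomorphism. -/
def IsRadical {X Y : C} (f : X ⟶ Y) : Prop :=
  ∀ (A : C), Indecomposable A → ∀ (g : A ⟶ X) (h : Y ⟶ A), ¬ IsIso (g ≫ f ≫ h)

/-- `X₁` is the isomorphism part of `h : Y ⟶ X[1]`: there are decompositions
`Y ≅ Y₁ ⊞ Y₂` and `X[1] ≅ X₁[1] ⊞ X₂[1]` for which `h` is the diagonal matrix of an
isomorphism `Y₁ ≅ X₁[1]` and of a radical morphism `Y₂ ⟶ X₂[1]`. -/
def IsIsoPart {X Y : C} (h : Y ⟶ X⟦(1 : ℤ)⟧) (X₁ : C) : Prop :=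
  ∃ (X₂ Y₁ Y₂ : C) (e : Y ≅ Y₁ ⊞ Y₂) (e' : X⟦(1 : ℤ)⟧ ≅ X₁⟦(1 : ℤ)⟧ ⊞ X₂⟦(1 : ℤ)⟧)
    (h₁ : Y₁ ≅ X₁⟦(1 : ℤ)⟧) (h₂ : Y₂ ⟶ X₂⟦(1 : ℤ)⟧),
    IsRadical h₂ ∧ h = e.hom ≫ biprod.map h₁.hom h₂ ≫ e'.inv

open Classical in
/-- A chosen object `X₁(α)`, the isomorphism part of the third morphism of a triangle in the
orbit `α` (and `0` if there were none). -/
def isoPart {X Y L : C} (α : TriOrbit X Y L) : C :=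
  if H : ∃ (A : C) (t : Tri X Y L), Quotient.mk (triSetoid X Y L) t = α ∧ IsIsoPart t.h A
  then H.choose else 0

/-- The derived Hall number
`F_{XY}^L = {X, Y} * ∑_{α ∈ V(X, Y; L)} |End X₁(α)| / |Aut X₁(α)|`. -/
def hallNumber (X Y L : C) : ℚ :=
  bracket X Y *
    ∑ᶠ α : TriOrbit X Y L, (Nat.card (End (isoPart α)) : ℚ) / Nat.card (Aut (isoPart α))

/-- `Hom(X, L)_Y`: the morphisms `X ⟶ L` whose cone is isomorphic to `Y`. -/
def homWithCone (X L Y : C) : Set (X ⟶ L) :=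
  {f | ∃ (g : L ⟶ Y) (h : Y ⟶ X⟦(1 : ℤ)⟧), Triangle.mk f g h ∈ distTriang C}

end Triangulated

/-- The isomorphism classes of objects of `C`. -/
abbrev IsoClass (C : Type u) [Category.{v} C] : Type u := Quotient (isIsomorphicSetoid C)

/-- The isomorphism class `[X]`. -/
abbrev isoClass {C : Type u} [Category.{v} C] (X : C) : IsoClass C :=
  Quotient.mk (isIsomorphicSetoid C) X

end

end DerivedHall

set_option linter.unusedSectionVars false

/-! Finite Hom sets and the vanishing of `Hom(X[i], Y)` for large `i` reduce everything to counting.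

The three forms of the Hall number. A triangle is determined up to the action by `f` alone, so `V(X,
Y; L)` is `Hom(X, L)_Y` modulo `Aut X`. The automorphisms fixing `f` are those with `a[1] = 1 + φh`
for some `φ : X[1] → Y`. Splitting `h` into the identity of an object `A` and a radical map, a Schur
complement shows that `1 + φh` is invertible for exactly the proportion `|Aut A| / |End A|` of all
`φ` (`HasIsoPart.card_isIso`). Hence the stabilizer has order `|Aut A| / |End A|` times the order of
the image of `Hom(X[1], Y)` in `End X[1]`, and the long exact sequence gives this image the order
`{X, L} / ({X, X}{X, Y})`. The weights `|End X₁| / |Aut X₁|` therefore turn a sum over orbits into a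
count of morphisms `f`, and dually into one of morphisms `g`.

Associativity. With the `g`-form for one factor and the `f`-form for the other, both sides become
sums over pairs `m : Z → M`, `y : M → Y`. Let `L` be the cone of `m` and `L'` the cocone of `y`. The
left side counts the factorizations `u : L → Y` of `y`, the right side the factorizations `v : Z →
L'` of `m`. Both kinds are parametrized by `Hom(Z[1], Y)`, and corresponding `u` and `v` satisfy
`cone u ≅ (cone v)[1]` (`nonempty_iso_cone_of_compatible`). The redundancies of the two
parametrizations differ exactly by the brackets. -/

namespace DerivedHall

/-! ### Radical morphisms and decomposition into indecomposables -/

section KrullSchmidt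

variable {C : Type u} [Category.{v} C] [Preadditive C] [HasZeroObject C] [HasShift C ℤ]
  [∀ n : ℤ, (shiftFunctor C n).Additive] [Pretriangulated C]

/-- Clearing the off-diagonal entries by unipotent matrices leaves the Schur complement of the
invertible corner. -/
theorem isIso_ofComponents_iff {X₁ X₂ Y₁ Y₂ : C} (f₁₁ : X₁ ⟶ Y₁) (f₁₂ : X₁ ⟶ Y₂)
    (f₂₁ : X₂ ⟶ Y₁) (f₂₂ : X₂ ⟶ Y₂) [IsIso f₂₂] :
    IsIso (Biprod.ofComponents f₁₁ f₁₂ f₂₁ f₂₂) ↔ IsIso (f₁₁ - f₁₂ ≫ inv f₂₂ ≫ f₂₁) := by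
  have h : (Biprod.unipotentUpper (-f₁₂ ≫ inv f₂₂)).hom ≫
      Biprod.ofComponents f₁₁ f₁₂ f₂₁ f₂₂ ≫ (Biprod.unipotentLower (-inv f₂₂ ≫ f₂₁)).hom =
      biprod.map (f₁₁ - f₁₂ ≫ inv f₂₂ ≫ f₂₁) f₂₂ := by
    ext <;> simp; abel
  constructor
  · intro _
    have : IsIso (biprod.map (f₁₁ - f₁₂ ≫ inv f₂₂ ≫ f₂₁) f₂₂) := by rw [← h]; infer_instance
    exact isIso_left_of_isIso_biprod_map _ f₂₂
  · intro _
    have : IsIso (biprod.map (f₁₁ - f₁₂ ≫ inv f₂₂ ≫ f₂₁) f₂₂) :=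
      (biprod.mapIso (asIso (f₁₁ - f₁₂ ≫ inv f₂₂ ≫ f₂₁)) (asIso f₂₂)).isIso_hom
    rw [← h] at this
    have := IsIso.of_isIso_comp_left (Biprod.unipotentUpper (-f₁₂ ≫ inv f₂₂)).hom
      (Biprod.ofComponents f₁₁ f₁₂ f₂₁ f₂₂ ≫ (Biprod.unipotentLower (-inv f₂₂ ≫ f₂₁)).hom)
    exact IsIso.of_isIso_comp_right _ (Biprod.unipotentLower (-inv f₂₂ ≫ f₂₁)).hom

/-- `1 + φ h` is invertible if and only if `1 + h φ` is. -/
theorem isIso_id_add_comp {Y Z : C} (h : Y ⟶ Z) (φ : Z ⟶ Y) [IsIso (𝟙 Z + φ ≫ h)] :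
    IsIso (𝟙 Y + h ≫ φ) := by
  have e₁ : inv (𝟙 Z + φ ≫ h) ≫ φ ≫ h = 𝟙 Z - inv (𝟙 Z + φ ≫ h) := by
    rw [eq_sub_iff_add_eq, add_comm]
    exact Eq.trans (by simp only [Preadditive.comp_add, Category.comp_id])
      (IsIso.inv_hom_id (𝟙 Z + φ ≫ h))
  have e₂ : φ ≫ h ≫ inv (𝟙 Z + φ ≫ h) = 𝟙 Z - inv (𝟙 Z + φ ≫ h) := by
    rw [eq_sub_iff_add_eq, add_comm]
    exact Eq.trans (by simp only [Preadditive.add_comp, Category.id_comp, Category.assoc])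
      (IsIso.hom_inv_id (𝟙 Z + φ ≫ h))
  -- The inverse suggested by the geometric series of `(1 + hφ)⁻¹`.
  refine ⟨𝟙 Y - h ≫ inv (𝟙 Z + φ ≫ h) ≫ φ, ?_, ?_⟩
  · have := congrArg (fun x => h ≫ x ≫ φ) e₂
    simp only [Preadditive.comp_sub, Preadditive.sub_comp, Category.assoc, Category.id_comp] at this
    simp [Preadditive.comp_sub, Preadditive.add_comp, this]
  · have := congrArg (fun x => h ≫ x ≫ φ) e₁
    simp only [Preadditive.comp_sub, Preadditive.sub_comp, Category.assoc, Category.id_comp] at this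
    simp [Preadditive.sub_comp, Preadditive.comp_add, this]

theorem isIso_id_add_comp_iff {Y Z : C} (h : Y ⟶ Z) (φ : Z ⟶ Y) :
    IsIso (𝟙 Z + φ ≫ h) ↔ IsIso (𝟙 Y + h ≫ φ) :=
  ⟨fun _ => isIso_id_add_comp h φ, fun _ => isIso_id_add_comp φ h⟩

section Finite

variable [∀ X Y : C, Finite (X ⟶ Y)]

theorem isIso_of_comp_eq_id {X : C} {f g : X ⟶ X} (h : f ≫ g = 𝟙 X) : IsIso f := by
  have : Finite (End X) := inferInstanceAs (Finite (X ⟶ X))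
  have h' : End.of f * End.of g = 1 := mul_eq_one_symm (a := End.of g) (b := End.of f) h
  exact ⟨g, h, h'⟩

theorem isIso_left_of_isIso_comp {X : C} {f : X ⟶ X} {g : X ⟶ X} [IsIso (f ≫ g)] : IsIso f :=
  isIso_of_comp_eq_id (g := g ≫ inv (f ≫ g)) (by rw [← Category.assoc, IsIso.hom_inv_id])

/-- The injection `f ↦ f ⊕ 0` misses the identity. Thus `|End X|` is the size on which the
inductions over direct summands run. -/
theorem card_hom_lt_of_biprod {X Y : C} (hY : ¬ IsZero Y) :
    Nat.card (X ⟶ X) < Nat.card ((X ⊞ Y) ⟶ (X ⊞ Y)) := by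
  have hinj : Function.Injective fun f : X ⟶ X => biprod.map f (0 : Y ⟶ Y) := fun f g hfg => by
    simpa using congrArg (fun t => biprod.inl ≫ t ≫ biprod.fst) hfg
  refine lt_of_le_of_ne (Nat.card_le_card_of_injective _ hinj) fun hcard => hY ?_
  obtain ⟨f, hf⟩ := (hinj.bijective_of_nat_card_le hcard.ge).2 (𝟙 _)
  rw [IsZero.iff_id_eq_zero]
  simpa using (congrArg (fun t => biprod.inr (X := X) ≫ t ≫ biprod.snd) hf).symm

theorem card_hom_congr {X Y : C} (e : X ≅ Y) : Nat.card (X ⟶ X) = Nat.card (Y ⟶ Y) :=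
  Nat.card_congr (e.homCongr e)

/-- A property of objects that is invariant under isomorphisms and direct sums holds for all
objects as soon as it holds for zero objects and indecomposable objects. -/
theorem induction_indecomposable {P : C → Prop} (iso : ∀ {X Y : C}, (X ≅ Y) → P X → P Y)
    (zero : ∀ X : C, IsZero X → P X) (indec : ∀ X : C, Indecomposable X → P X)
    (sum : ∀ X Y : C, P X → P Y → P (X ⊞ Y)) (X : C) : P X := by
  induction hn : Nat.card (X ⟶ X) using Nat.strong_induction_on generalizing X with
  | _ n ih =>
  by_cases h0 : IsZero X
  · exact zero X h0
  by_cases hi : Indecomposable X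
  · exact indec X hi
  obtain ⟨Y, Z, e, hY, hZ⟩ : ∃ (Y Z : C) (_ : X ≅ Y ⊞ Z), ¬ IsZero Y ∧ ¬ IsZero Z := by
    by_contra hcon
    push Not at hcon
    exact hi ⟨h0, fun Y Z e => or_iff_not_imp_left.2 fun hY => by simpa using hcon Y Z e hY⟩
  subst hn
  refine iso e.symm (sum Y Z (ih _ ?_ Y rfl) (ih _ ?_ Z rfl))
  · exact (card_hom_lt_of_biprod hZ).trans_eq (card_hom_congr e).symm
  · exact (card_hom_lt_of_biprod hY).trans_eq
      (card_hom_congr (e ≪≫ biprod.braiding Y Z)).symm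

end Finite

section Radical

variable {X Y Z : C}

theorem IsRadical.comp_left {f : Y ⟶ Z} (hf : IsRadical f) (g : X ⟶ Y) : IsRadical (g ≫ f) :=
  fun A hA a b h => hf A hA (a ≫ g) b (by simpa using h)

theorem IsRadical.comp_right {f : X ⟶ Y} (hf : IsRadical f) (g : Y ⟶ Z) : IsRadical (f ≫ g) :=
  fun A hA a b h => hf A hA a (g ≫ b) (by simpa using h)

theorem IsRadical.neg {f : X ⟶ Y} (hf : IsRadical f) : IsRadical (-f) := by
  simpa using hf.comp_left (-𝟙 X)

theorem isIso_or_isIso_of_isIso_add [IsLocalRing (End X)] {f g : X ⟶ X} (h : IsIso (f + g)) :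
    IsIso f ∨ IsIso g :=
  (IsLocalRing.isUnit_or_isUnit_of_isUnit_add (R := End X) (a := f) (b := g)
    ((isUnit_iff_isIso (f + g)).2 h)).imp (isUnit_iff_isIso _).1 (isUnit_iff_isIso _).1

theorem IsRadical.add (hloc : ∀ X : C, Indecomposable X → IsLocalRing (End X)) {f g : X ⟶ Y}
    (hf : IsRadical f) (hg : IsRadical g) :
    IsRadical (f + g) := fun A hA a b h => by
  have := hloc A hA
  rw [Preadditive.add_comp, Preadditive.comp_add] at h
  exact (isIso_or_isIso_of_isIso_add h).elim (hf A hA a b) (hg A hA a b)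

/-- Radical endomorphisms lie in the Jacobson radical. -/
theorem IsRadical.isIso_id_add (hloc : ∀ X : C, Indecomposable X → IsLocalRing (End X))
    [∀ X Y : C, Finite (X ⟶ Y)] {n : X ⟶ X} (hn : IsRadical n) :
    IsIso (𝟙 X + n) := by
  revert n
  refine induction_indecomposable (P := fun X => ∀ {n : X ⟶ X}, IsRadical n → IsIso (𝟙 X + n))
    ?_ ?_ ?_ ?_ X
  · intro X Y e ih n hn
    have := ih ((hn.comp_left e.hom).comp_right e.inv)
    have h2 : 𝟙 Y + n = e.inv ≫ (𝟙 X + (e.hom ≫ n) ≫ e.inv) ≫ e.hom := by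
      simp [Preadditive.comp_add, Preadditive.add_comp]
    rw [h2]
    infer_instance
  · intro X hX n _
    exact ⟨𝟙 X, hX.eq_of_src _ _, hX.eq_of_src _ _⟩
  · intro X hX n hn
    have := hloc X hX
    have h' : IsIso ((𝟙 X + n) + (-n)) := by
      rw [add_neg_cancel_right]
      infer_instance
    exact (isIso_or_isIso_of_isIso_add h').resolve_right (by simpa using hn.neg X hX (𝟙 X) (𝟙 X))
  · intro X Y hX hY n hn
    have h₁ : IsIso (𝟙 Y + biprod.inr ≫ n ≫ biprod.snd) :=
      hY ((hn.comp_right _).comp_left _)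
    have h₂ : 𝟙 (X ⊞ Y) + n = Biprod.ofComponents (𝟙 X + biprod.inl ≫ n ≫ biprod.fst)
        (biprod.inl ≫ n ≫ biprod.snd) (biprod.inr ≫ n ≫ biprod.fst)
        (𝟙 Y + biprod.inr ≫ n ≫ biprod.snd) := by
      ext <;> simp [Preadditive.comp_add, Preadditive.add_comp]
    -- The Schur complement is again the identity plus a radical map, since the correction term
    -- factors through an entry of `n`.
    rw [h₂, isIso_ofComponents_iff, sub_eq_add_neg, add_assoc]
    refine hX (IsRadical.add hloc ((hn.comp_right _).comp_left _) ?_)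
    simpa using ((hn.comp_right biprod.snd).comp_left biprod.inl).comp_right
      (inv (𝟙 Y + biprod.inr ≫ n ≫ biprod.snd) ≫ biprod.inr ≫ n ≫ biprod.fst) |>.neg

end Radical

end KrullSchmidt

/-! ### The isomorphism part of a morphism -/

section IsoPart

variable {C : Type u} [Category.{v} C] [Preadditive C] [HasZeroObject C] [HasShift C ℤ]
  [∀ n : ℤ, (shiftFunctor C n).Additive] [Pretriangulated C]

/-- The complement is the cone: the third map of the triangle on a monomorphism vanishes, so the
triangle splits. -/
theorem exists_iso_biprod_of_isSplitMono {D Y : C} (s : D ⟶ Y) [IsSplitMono s] :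
    ∃ (Y' : C) (e : Y ≅ D ⊞ Y'), s ≫ e.hom = biprod.inl := by
  obtain ⟨Y', g, h, hT⟩ := distinguished_cocone_triangle s
  obtain ⟨e, he, -⟩ := exists_iso_binaryBiproduct_of_distTriang _ hT
    (Triangle.mor₃_eq_zero_of_mono₁ _ hT (inferInstanceAs (Mono s)))
  exact ⟨Y', e, he⟩

/-- `h` is the diagonal matrix of the identity of `A` and a radical morphism, up to
isomorphisms of source and target. -/
def HasIsoPart {Y Z : C} (h : Y ⟶ Z) (A : C) : Prop :=
  ∃ (Y₂ Z₂ : C) (e : Y ≅ A ⊞ Y₂) (e' : Z ≅ A ⊞ Z₂) (r : Y₂ ⟶ Z₂),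
    IsRadical r ∧ h = e.hom ≫ biprod.map (𝟙 A) r ≫ e'.inv

theorem IsIsoPart.hasIsoPart {X Y A : C} {h : Y ⟶ X⟦(1 : ℤ)⟧} (H : IsIsoPart h A) :
    HasIsoPart h (A⟦(1 : ℤ)⟧) := by
  obtain ⟨X₂, Y₁, Y₂, e, e', h₁, h₂, hr, rfl⟩ := H
  refine ⟨Y₂, X₂⟦(1 : ℤ)⟧, e ≪≫ biprod.mapIso h₁ (Iso.refl _), e', h₂, hr, ?_⟩
  have : biprod.map h₁.hom h₂ = biprod.map h₁.hom (𝟙 Y₂) ≫ biprod.map (𝟙 _) h₂ := by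
    ext <;> simp
  simp [this]

theorem HasIsoPart.exists_isIsoPart {X Y A : C} {h : Y ⟶ X⟦(1 : ℤ)⟧} (H : HasIsoPart h A) :
    ∃ X₁, IsIsoPart h X₁ := by
  obtain ⟨Y₂, Z₂, e, e', r, hr, rfl⟩ := H
  refine ⟨A⟦(-1 : ℤ)⟧, Z₂⟦(-1 : ℤ)⟧, A, Y₂, e, e' ≪≫ biprod.mapIso
    (shiftNegShift A (1 : ℤ)).symm (shiftNegShift Z₂ (1 : ℤ)).symm,
    (shiftNegShift A (1 : ℤ)).symm, r ≫ (shiftNegShift Z₂ (1 : ℤ)).inv, hr.comp_right _, ?_⟩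
  have key : biprod.map (shiftNegShift A (1 : ℤ)).inv (r ≫ (shiftNegShift Z₂ (1 : ℤ)).inv) ≫
      biprod.map (shiftNegShift A (1 : ℤ)).hom (shiftNegShift Z₂ (1 : ℤ)).hom =
      biprod.map (𝟙 A) r := by
    ext <;> simp only [biprod.map_fst, biprod.map_snd, biprod.map_fst_assoc, biprod.map_snd_assoc,
      Category.assoc, Iso.inv_hom_id, Category.comp_id]
  simp only [Iso.trans_inv, biprod.mapIso_inv, Iso.symm_inv, Iso.symm_hom]
  rw [← Category.assoc (biprod.map _ _), key]

variable [∀ X Y : C, Finite (X ⟶ Y)]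

theorem exists_hasIsoPart {Y Z : C} (h : Y ⟶ Z) : ∃ A, HasIsoPart h A := by
  induction hn : Nat.card (Y ⟶ Y) using Nat.strong_induction_on generalizing Y Z with
  | _ n ih =>
  by_cases hr : IsRadical h
  · exact ⟨0, Y, Z, isoZeroBiprod (isZero_zero C), isoZeroBiprod (isZero_zero C), h, hr, by simp⟩
  obtain ⟨D, hD, g, p, hp⟩ : ∃ D, Indecomposable D ∧ ∃ (g : D ⟶ Y) (p : Z ⟶ D),
      IsIso (g ≫ h ≫ p) := by
    simpa [IsRadical] using hr
  have : IsSplitMono g := ⟨⟨h ≫ p ≫ inv (g ≫ h ≫ p), by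
    simpa only [Category.assoc] using IsIso.hom_inv_id (g ≫ h ≫ p)⟩⟩
  have : IsSplitMono (g ≫ h) :=
    ⟨⟨p ≫ inv (g ≫ h ≫ p), by simpa only [Category.assoc] using IsIso.hom_inv_id (g ≫ h ≫ p)⟩⟩
  -- `D` is a summand of `Y` via `g` and of `Z` via `g ≫ h`, so the corner of `h` at `D` is the
  -- identity. Gaussian elimination splits it off and leaves a map with smaller source.
  obtain ⟨Y', e, he⟩ := exists_iso_biprod_of_isSplitMono g
  obtain ⟨Z', e', he'⟩ := exists_iso_biprod_of_isSplitMono (g ≫ h)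
  have hg : biprod.inl ≫ e.inv = g := by rw [← he]; simp
  have h11 : biprod.inl ≫ (e.inv ≫ h ≫ e'.hom) ≫ biprod.fst = 𝟙 D := by
    rw [Category.assoc, reassoc_of% hg, Category.assoc]
    simpa using congrArg (· ≫ biprod.fst) he'
  have : IsIso (biprod.inl ≫ (e.inv ≫ h ≫ e'.hom) ≫ biprod.fst) := by rw [h11]; infer_instance
  obtain ⟨L, R, h', hh⟩ := Biprod.gaussian (e.inv ≫ h ≫ e'.hom)
  rw [h11] at hh
  have hlt : Nat.card (Y' ⟶ Y') < n := hn ▸ (card_hom_lt_of_biprod hD.1).trans_eq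
    (card_hom_congr (e ≪≫ biprod.braiding D Y')).symm
  obtain ⟨A, Y₂, Z₂, e₂, e₂', r, hr, rfl⟩ := ih _ hlt h' rfl
  refine ⟨D ⊞ A, Y₂, Z₂, e ≪≫ L.symm ≪≫ biprod.mapIso (Iso.refl D) e₂ ≪≫
    (biprod.associator _ _ _).symm, e' ≪≫ R ≪≫ biprod.mapIso (Iso.refl D) e₂' ≪≫
    (biprod.associator _ _ _).symm, r, hr, ?_⟩
  have key : biprod.map (𝟙 D) (e₂.hom ≫ biprod.map (𝟙 A) r ≫ e₂'.inv) =
      biprod.map (𝟙 D) e₂.hom ≫ (biprod.associator _ _ _).inv ≫ biprod.map (𝟙 (D ⊞ A)) r ≫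
        (biprod.associator _ _ _).hom ≫ biprod.map (𝟙 D) e₂'.inv := by
    have : 𝟙 (D ⊞ A) = biprod.map (𝟙 D) (𝟙 A) := by ext <;> simp
    rw [this, biprod.associator_natural_assoc, Iso.inv_hom_id_assoc]
    ext <;> simp
  rw [key] at hh
  rw [← cancel_epi e.inv, ← cancel_epi L.hom, ← cancel_mono e'.hom, ← cancel_mono R.hom]
  simpa using hh

section Local

variable (hloc : ∀ X : C, Indecomposable X → IsLocalRing (End X))
include hloc

/-- The identity of `A` factors through `h`. Expanding `h` in its other decomposition writes this
identity as a map through `B` plus a radical map, so the map through `B` is invertible. -/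
theorem HasIsoPart.exists_retract {Y Z A B : C} {h : Y ⟶ Z} (hA : HasIsoPart h A)
    (hB : HasIsoPart h B) : ∃ (s : A ⟶ B) (r : B ⟶ A), s ≫ r = 𝟙 A := by
  obtain ⟨Y₂, Z₂, e, e', r, hr, rfl⟩ := hA
  obtain ⟨Y₃, Z₃, f, f', r', hr', he⟩ := hB
  have h₁ : biprod.inl ≫ e.inv ≫ (e.hom ≫ biprod.map (𝟙 A) r ≫ e'.inv) ≫ e'.hom ≫ biprod.fst =
      𝟙 A := by simp
  have h₂ : biprod.map (𝟙 B) r' = biprod.fst ≫ biprod.inl + biprod.snd ≫ r' ≫ biprod.inr := by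
    ext <;> simp
  rw [he, h₂] at h₁
  simp only [Preadditive.add_comp, Preadditive.comp_add, Category.assoc] at h₁
  rw [← eq_sub_iff_add_eq, sub_eq_add_neg] at h₁
  have h₃ : IsRadical (-(biprod.inl ≫ e.inv ≫ f.hom ≫ biprod.snd ≫ r' ≫ biprod.inr ≫
      f'.inv ≫ e'.hom ≫ biprod.fst)) := by
    simpa using (((hr'.comp_left (biprod.inl ≫ e.inv ≫ f.hom ≫ biprod.snd)).comp_right
      (biprod.inr ≫ f'.inv ≫ e'.hom ≫ biprod.fst))).neg
  have := h₃.isIso_id_add hloc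
  rw [← h₁] at this
  exact ⟨biprod.inl ≫ e.inv ≫ f.hom ≫ biprod.fst,
    (biprod.inl ≫ f'.inv ≫ e'.hom ≫ biprod.fst) ≫ inv (biprod.inl ≫ e.inv ≫ f.hom ≫
      biprod.fst ≫ biprod.inl ≫ f'.inv ≫ e'.hom ≫ biprod.fst), by
    simpa only [Category.assoc] using IsIso.hom_inv_id (biprod.inl ≫ e.inv ≫ f.hom ≫
      biprod.fst ≫ biprod.inl ≫ f'.inv ≫ e'.hom ≫ biprod.fst)⟩

/-- Mutual retracts with finite endomorphism rings are isomorphic, because one-sided inverses in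
such rings are two-sided. -/
theorem HasIsoPart.nonempty_iso {Y Z A B : C} {h : Y ⟶ Z} (hA : HasIsoPart h A)
    (hB : HasIsoPart h B) : Nonempty (A ≅ B) := by
  obtain ⟨s, r, hs⟩ := hA.exists_retract hloc hB
  obtain ⟨s', r', hs'⟩ := hB.exists_retract hloc hA
  have : IsIso (s ≫ s') := isIso_of_comp_eq_id (g := r' ≫ r) (by simp [reassoc_of% hs', hs])
  have : IsSplitEpi s' := ⟨⟨inv (s ≫ s') ≫ s, by simp⟩⟩
  have : IsSplitMono s' := ⟨⟨r', hs'⟩⟩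
  have := isIso_of_mono_of_isSplitEpi s'
  exact ⟨(asIso s').symm⟩

/-- Direct summands cancel. -/
theorem nonempty_iso_of_biprod_iso (M : C) :
    ∀ {A B : C}, (M ⊞ A ≅ M ⊞ B) → Nonempty (A ≅ B) := by
  refine induction_indecomposable
    (P := fun M => ∀ {A B : C}, (M ⊞ A ≅ M ⊞ B) → Nonempty (A ≅ B)) ?_ ?_ ?_ ?_ M
  · intro M N i ih A B e
    exact ih (biprod.mapIso i (Iso.refl A) ≪≫ e ≪≫ biprod.mapIso i.symm (Iso.refl B))
  · intro M hM A B e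
    exact ⟨isoZeroBiprod hM ≪≫ e ≪≫ (isoZeroBiprod hM).symm⟩
  · intro M hM A B e
    have := hloc M hM
    by_cases ha : IsIso (biprod.inl ≫ e.hom ≫ biprod.fst)
    · exact ⟨Biprod.isoElim e⟩
    -- If the corner `e₁₁` is not invertible, locality applied to `e₁₁e'₁₁ + e₁₂e'₂₁ = 1`, with `e'`
    -- the inverse of `e`, makes `e₁₂e'₂₁` invertible. Then `e₁₁ + e₁₂e'₂₁` is invertible too, and
    -- it is the corner of `e` after a unipotent change of the target.
    have h₁ : (biprod.inl ≫ e.hom ≫ biprod.fst) ≫ biprod.inl ≫ e.inv ≫ biprod.fst +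
        (biprod.inl ≫ e.hom ≫ biprod.snd) ≫ biprod.inr ≫ e.inv ≫ biprod.fst = 𝟙 M := by
      have := congrArg (fun t => biprod.inl ≫ e.hom ≫ t ≫ e.inv ≫ biprod.fst)
        (biprod.total (X := M) (Y := B))
      simp only [Preadditive.add_comp, Preadditive.comp_add, Category.assoc, Category.id_comp,
        Iso.hom_inv_id_assoc, biprod.inl_fst] at this
      simpa only [Category.assoc] using this
    have h₂ : IsIso ((biprod.inl ≫ e.hom ≫ biprod.snd) ≫ biprod.inr ≫ e.inv ≫ biprod.fst) :=
      (isIso_or_isIso_of_isIso_add (by rw [h₁]; infer_instance)).resolve_left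
        fun _ => ha (isIso_left_of_isIso_comp (g := biprod.inl ≫ e.inv ≫ biprod.fst))
    have h₃ : IsIso (((biprod.inl ≫ e.hom ≫ biprod.fst) +
        (biprod.inl ≫ e.hom ≫ biprod.snd) ≫ biprod.inr ≫ e.inv ≫ biprod.fst) +
        -(biprod.inl ≫ e.hom ≫ biprod.fst)) := by
      rwa [add_neg_cancel_comm]
    have h₄ := (isIso_or_isIso_of_isIso_add h₃).resolve_right fun _ => ha
      ⟨-inv (-(biprod.inl ≫ e.hom ≫ biprod.fst)),
        by rw [Preadditive.comp_neg, ← Preadditive.neg_comp, IsIso.hom_inv_id],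
        by rw [Preadditive.neg_comp, ← Preadditive.comp_neg, IsIso.inv_hom_id]⟩
    have : IsIso (biprod.inl ≫ (e ≪≫ Biprod.unipotentLower
        (biprod.inr ≫ e.inv ≫ biprod.fst)).hom ≫ biprod.fst) := by
      convert h₄ using 1
      simp [Preadditive.comp_add]
    exact ⟨Biprod.isoElim (e ≪≫ Biprod.unipotentLower (biprod.inr ≫ e.inv ≫ biprod.fst))⟩
  · intro M N hM hN A B e
    obtain ⟨i⟩ := hM ((biprod.associator M N A).symm ≪≫ e ≪≫ biprod.associator M N B)
    exact hN i

/-- Write `φ` as a matrix with entries `a, b, c, d`. As `dr` is radical, `1 + dr` is invertible, and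
`1 + φh` is invertible exactly when `1 + a - br(1 + dr)⁻¹c` is. For fixed `b, c, d` this is a
translate of `a`, hence lies in `Aut A` for `|Aut A|` values of `a`. -/
theorem HasIsoPart.card_isIso {Y Z A : C} {h : Y ⟶ Z} (hA : HasIsoPart h A) :
    Nat.card {φ : Z ⟶ Y // IsIso (𝟙 Z + φ ≫ h)} * Nat.card (A ⟶ A) =
      Nat.card (Aut A) * Nat.card (Z ⟶ Y) := by
  obtain ⟨Y₂, Z₂, e, e', r, hr, rfl⟩ := hA
  have hd (d : Z₂ ⟶ Y₂) : IsIso (𝟙 Z₂ + d ≫ r) := (hr.comp_left d).isIso_id_add hloc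
  let R := (A ⟶ Y₂) × (Z₂ ⟶ A) × (Z₂ ⟶ Y₂)
  let F : (A ⟶ A) × R ≃ (Z ⟶ Y) :=
    { toFun := fun p => e'.hom ≫ Biprod.ofComponents p.1 p.2.1 p.2.2.1 p.2.2.2 ≫ e.inv
      invFun := fun φ => (biprod.inl ≫ (e'.inv ≫ φ ≫ e.hom) ≫ biprod.fst,
        biprod.inl ≫ (e'.inv ≫ φ ≫ e.hom) ≫ biprod.snd,
        biprod.inr ≫ (e'.inv ≫ φ ≫ e.hom) ≫ biprod.fst,
        biprod.inr ≫ (e'.inv ≫ φ ≫ e.hom) ≫ biprod.snd)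
      left_inv := fun p => by simp
      right_inv := fun φ => by
        dsimp only
        rw [Biprod.ofComponents_eq]
        simp }
  let s : R → (A ⟶ A) := fun p => (p.1 ≫ r) ≫ inv (𝟙 Z₂ + p.2.2 ≫ r) ≫ p.2.1
  let T : (A ⟶ A) × R ≃ (A ⟶ A) × R :=
    { toFun := fun p => (𝟙 A + p.1 - s p.2, p.2)
      invFun := fun p => (p.1 + s p.2 - 𝟙 A, p.2)
      left_inv := fun p => by ext1 <;> simp
      right_inv := fun p => by ext1 <;> simp }
  have hFT (p : (A ⟶ A) × R) : IsIso (T p).1 ↔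
      IsIso (𝟙 Z + F p ≫ e.hom ≫ biprod.map (𝟙 A) r ≫ e'.inv) := by
    change IsIso (𝟙 A + p.1 - (p.2.1 ≫ r) ≫ inv (𝟙 Z₂ + p.2.2.2 ≫ r) ≫ p.2.2.1) ↔ _
    rw [← isIso_ofComponents_iff]
    have : 𝟙 Z + F p ≫ e.hom ≫ biprod.map (𝟙 A) r ≫ e'.inv = e'.hom ≫
        Biprod.ofComponents (𝟙 A + p.1) (p.2.1 ≫ r) p.2.2.1 (𝟙 Z₂ + p.2.2.2 ≫ r) ≫ e'.inv := by
      rw [← cancel_epi e'.inv, ← cancel_mono e'.hom]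
      ext <;> simp [F, Biprod.ofComponents, Preadditive.comp_add, Preadditive.add_comp]
    rw [this]
    constructor
    · intro _
      infer_instance
    · intro _
      have := IsIso.of_isIso_comp_left e'.hom (Biprod.ofComponents (𝟙 A + p.1) (p.2.1 ≫ r)
        p.2.2.1 (𝟙 Z₂ + p.2.2.2 ≫ r) ≫ e'.inv)
      exact IsIso.of_isIso_comp_right _ e'.inv
  have hAut : Nat.card {a : A ⟶ A // IsIso a} = Nat.card (Aut A) :=
    Nat.card_congr
      { toFun := fun a => have := a.2; asIso a.1
        invFun := fun a => ⟨a.hom, Iso.isIso_hom a⟩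
        left_inv := fun a => rfl
        right_inv := fun a => by ext; rfl }
  have h₁ : Nat.card {φ : Z ⟶ Y // IsIso (𝟙 Z + φ ≫ e.hom ≫ biprod.map (𝟙 A) r ≫ e'.inv)} =
      Nat.card (Aut A) * Nat.card R := by
    rw [← hAut, ← Nat.card_prod]
    refine Nat.card_congr (((F.subtypeEquiv hFT).symm.trans
      (T.subtypeEquiv (q := fun p => IsIso p.1) fun p => Iff.rfl)).trans
      Equiv.prodSubtypeFstEquivSubtypeProd)
  rw [h₁, ← Nat.card_congr F, Nat.card_prod (A ⟶ A) R, mul_assoc, mul_comm (Nat.card R)]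

end Local

end IsoPart

/-! ### Counting in cosets -/

section Counting

theorem card_ker_mul_card_range {G H : Type*} [AddGroup G] [AddGroup H] (ψ : G →+ H) :
    Nat.card ψ.ker * Nat.card ψ.range = Nat.card G := by
  rw [← AddSubgroup.index_ker, AddSubgroup.card_mul_index]

/-- Counting the elements of a coset of the range of `ψ` with a given property. -/
theorem card_subtype_add_apply {G H : Type*} [AddCommGroup G] [AddCommGroup H] [Finite G]
    [Finite H] (ψ : G →+ H) (a : H) (P : H → Prop) :
    Nat.card {g : G // P (a + ψ g)} =
      Nat.card ψ.ker * Nat.card {x : H // x - a ∈ ψ.range ∧ P x} := by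
  classical
  let F : {g : G // P (a + ψ g)} → {x : H // x - a ∈ ψ.range ∧ P x} := fun g =>
    ⟨a + ψ g.1, by simp, g.2⟩
  have : Fintype {x : H // x - a ∈ ψ.range ∧ P x} := Fintype.ofFinite _
  have hF (x : {x : H // x - a ∈ ψ.range ∧ P x}) :
      Nat.card {g // F g = x} = Nat.card ψ.ker := by
    obtain ⟨x, ⟨g₀, hg₀⟩, hx⟩ := x
    have hg₀' : a + ψ g₀ = x := by rw [hg₀]; abel
    refine Nat.card_congr
      { toFun := fun g => ⟨g.1.1 - g₀, ?_⟩
        invFun := fun n => ⟨⟨n.1 + g₀, ?_⟩, ?_⟩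
        left_inv := fun g => by ext; simp
        right_inv := fun n => by ext; simp }
    · have := congrArg Subtype.val g.2
      rw [AddMonoidHom.mem_ker, map_sub, sub_eq_zero]
      exact add_left_cancel (this.trans hg₀'.symm)
    · rw [map_add, (AddMonoidHom.mem_ker).1 n.2, zero_add, hg₀']
      exact hx
    · ext
      simp only [F]
      rw [map_add, (AddMonoidHom.mem_ker).1 n.2, zero_add, hg₀']
  rw [← Nat.card_congr (Equiv.sigmaFiberEquiv F), Nat.card_sigma, Finset.sum_congr rfl
    fun x _ => hF x, Finset.sum_const, Finset.card_univ, smul_eq_mul, mul_comm,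
    Nat.card_eq_fintype_card (α := {x : H // x - a ∈ ψ.range ∧ P x})]

end Counting

/-! ### The bracket and long exact sequences -/

section Bracket

/-- The inductive step along a long exact sequence: the `s`'s are orders of consecutive images, so
products of neighbours are orders of Hom groups, and `b'` denotes a bracket of shifted objects. In
`e₂` the shifted middle bracket is already replaced by `s₃ * b₁' * b₃'`, the induction hypothesis.
-/
theorem bracket_step {b₁ b₂ b₃ b₁' b₃' s₀ s₁ s₂ s₃ : ℚ}
    (e₁ : b₁ * (s₁ * s₀) * b₁' = 1) (e₂ : b₂ * (s₂ * s₁) * (s₃ * b₁' * b₃') = 1)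
    (e₃ : b₃ * (s₃ * s₂) * b₃' = 1) : s₀ * b₁ * b₃ = b₂ := by
  have : (s₂ * s₁) * (s₃ * b₁' * b₃') ≠ 0 := fun h => by
    rw [mul_assoc, h, mul_zero] at e₂
    exact zero_ne_one e₂
  apply mul_right_cancel₀ this
  linear_combination e₁ * b₃ * (s₃ * s₂) * b₃' + e₃ - e₂

variable {C : Type u} [Category.{v} C] [Preadditive C] [HasZeroObject C] [HasShift C ℤ]
  [∀ n : ℤ, (shiftFunctor C n).Additive] [Pretriangulated C]

theorem card_hom_congr₂ {X X' Y Y' : C} (e : X ≅ X') (e' : Y ≅ Y') :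
    Nat.card (X ⟶ Y) = Nat.card (X' ⟶ Y') :=
  Nat.card_congr (e.homCongr e')

theorem bracket_congr {X X' Y Y' : C} (e : X ≅ X') (e' : Y ≅ Y') :
    bracket X Y = bracket X' Y' := by
  unfold bracket
  refine finprod_congr fun i => finprod_congr fun _ => ?_
  rw [card_hom_congr₂ ((shiftFunctor C (i : ℤ)).mapIso e) e']

theorem bracket_eq_prod {X Y : C} {N : ℕ}
    (h : ∀ i : ℕ, N < i → Subsingleton (X⟦(i : ℤ)⟧ ⟶ Y)) :
    bracket X Y = ∏ i ∈ Finset.range N,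
      (Nat.card (X⟦((i + 1 : ℕ) : ℤ)⟧ ⟶ Y) : ℚ) ^ ((-1 : ℤ) ^ (i + 1)) := by
  unfold bracket
  simp only [finprod_eq_if]
  rw [finprod_eq_prod_of_mulSupport_subset (s := Finset.range (N + 1)), Finset.prod_range_succ']
  · simp
  · intro i hi
    by_contra hN
    have hN : N < i := by simpa using hN
    have := h i hN
    exact hi (by simp)

theorem subsingleton_shift_hom {X Y : C} {N : ℕ}
    (h : ∀ i : ℕ, N + 1 < i → Subsingleton (X⟦(i : ℤ)⟧ ⟶ Y)) (i : ℕ) (hi : N < i) :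
    Subsingleton (X⟦(1 : ℤ)⟧⟦(i : ℤ)⟧ ⟶ Y) := by
  have := h (i + 1) (by omega)
  exact (((shiftFunctorAdd' C (1 : ℤ) i ((i + 1 : ℕ) : ℤ) (by push_cast; ring)).app X).homCongr
    (Iso.refl Y)).symm.subsingleton

variable [∀ X Y : C, Finite (X ⟶ Y)]

theorem card_hom_ne_zero (X Y : C) : (Nat.card (X ⟶ Y) : ℚ) ≠ 0 :=
  Nat.cast_ne_zero.2 Nat.card_pos.ne'

section Vanishing

variable (hvan : ∀ X Y : C, ∃ N : ℕ, ∀ i : ℕ, N < i → Subsingleton (X⟦(i : ℤ)⟧ ⟶ Y))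
include hvan

theorem bracket_ne_zero (X Y : C) : bracket X Y ≠ 0 := by
  obtain ⟨N, hN⟩ := hvan X Y
  rw [bracket_eq_prod hN]
  exact Finset.prod_ne_zero_iff.2 fun i _ => zpow_ne_zero _ (card_hom_ne_zero _ _)

theorem bracket_mul_card_mul_bracket_shift (X Y : C) :
    bracket X Y * Nat.card (X⟦(1 : ℤ)⟧ ⟶ Y) * bracket (X⟦(1 : ℤ)⟧) Y = 1 := by
  obtain ⟨N, hN⟩ := hvan X Y
  -- The bound for `X` is taken one larger than that for `X[1]`, so that the factor of `X[1]` at `i`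
  -- cancels that of `X` at `i + 1`; only the factor `|Hom(X[1], Y)|⁻¹` remains.
  rw [bracket_eq_prod (N := N + 1) fun i hi => hN i (by omega),
    bracket_eq_prod (N := N) (subsingleton_shift_hom fun i hi => hN i (by omega)),
    Finset.prod_range_succ']
  have h1 : ((Nat.card (X⟦((0 + 1 : ℕ) : ℤ)⟧ ⟶ Y) : ℚ) ^ ((-1 : ℤ) ^ (0 + 1))) *
      Nat.card (X⟦(1 : ℤ)⟧ ⟶ Y) = 1 := by
    simp only [zero_add, Nat.cast_one, pow_one, zpow_neg_one]
    exact inv_mul_cancel₀ (card_hom_ne_zero _ _)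
  rw [mul_assoc (Finset.prod _ _), h1, mul_one, ← Finset.prod_mul_distrib]
  refine Finset.prod_eq_one fun i _ => ?_
  rw [card_hom_congr₂ ((shiftFunctorAdd' C (1 : ℤ) ((i + 1 : ℕ) : ℤ) ((i + 1 + 1 : ℕ) : ℤ)
    (by push_cast; ring)).app X) (Iso.refl Y)]
  rw [pow_succ (-1 : ℤ) (i + 1), mul_neg_one, zpow_neg]
  exact inv_mul_cancel₀ (zpow_ne_zero _ (card_hom_ne_zero _ _))

/-- Counting along the long exact sequence of `Hom(-, B)`. -/
theorem card_range_leftComp_mul_bracket (T : Triangle C) (hT : T ∈ distTriang C) (B : C) :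
    (Nat.card (Preadditive.leftComp B T.mor₃).range : ℚ) *
      bracket T.obj₁ B * bracket T.obj₃ B = bracket T.obj₂ B := by
  have step (T : Triangle C) (hT : T ∈ distTriang C) : Nat.card (T.obj₁⟦(1 : ℤ)⟧ ⟶ B) =
      Nat.card (Preadditive.leftComp B T.rotate.mor₃).range *
        Nat.card (Preadditive.leftComp B T.mor₃).range := by
    rw [← card_ker_mul_card_range (Preadditive.leftComp B T.mor₃)]
    congr 2
    have : (Preadditive.leftComp B T.mor₃).ker = (Preadditive.leftComp B T.rotate.mor₃).range := by
      ext x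
      constructor
      · intro hx
        obtain ⟨y, hy⟩ := Triangle.yoneda_exact₃ _ (rot_of_distTriang _ hT) x hx
        exact ⟨y, hy.symm⟩
      · rintro ⟨y, rfl⟩
        have := comp_distTriang_mor_zero₂₃ _ (rot_of_distTriang _ hT)
        exact ((Category.assoc _ _ _).symm.trans (congrArg (· ≫ y) this)).trans zero_comp
    rw [this]
    rfl
  -- Induction on the vanishing bound: rotating three times replaces the objects by their shifts,
  -- which lowers the bound by one.
  have key (N : ℕ) : ∀ T ∈ distTriang C,
      (∀ i : ℕ, N < i → Subsingleton (T.obj₁⟦(i : ℤ)⟧ ⟶ B)) →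
      (∀ i : ℕ, N < i → Subsingleton (T.obj₂⟦(i : ℤ)⟧ ⟶ B)) →
      (∀ i : ℕ, N < i → Subsingleton (T.obj₃⟦(i : ℤ)⟧ ⟶ B)) →
      (Nat.card (Preadditive.leftComp B T.mor₃).range : ℚ) *
        bracket T.obj₁ B * bracket T.obj₃ B = bracket T.obj₂ B := by
    induction N with
    | zero =>
      intro T hT h₁ h₂ h₃
      have := h₁ 1 one_pos
      have h : Nat.card (T.obj₁⟦(1 : ℤ)⟧ ⟶ B) = 1 := Nat.card_unique
      rw [step T hT, mul_eq_one] at h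
      rw [bracket_eq_prod h₁, bracket_eq_prod h₂, bracket_eq_prod h₃, h.2]
      simp
    | succ N ih =>
      intro T hT h₁ h₂ h₃
      have hT₁ := rot_of_distTriang _ hT
      have hT₂ := rot_of_distTriang _ hT₁
      have hT₃ := rot_of_distTriang _ hT₂
      have h := ih _ hT₃ (subsingleton_shift_hom h₁) (subsingleton_shift_hom h₂)
        (subsingleton_shift_hom h₃)
      have e₁ := step _ hT
      have e₂ := step _ hT₁
      have e₃ := step _ hT₂
      change Nat.card (T.obj₂⟦(1 : ℤ)⟧ ⟶ B) = _ at e₂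
      change Nat.card (T.obj₃⟦(1 : ℤ)⟧ ⟶ B) = _ at e₃
      change _ * bracket (T.obj₁⟦(1 : ℤ)⟧) B * bracket (T.obj₃⟦(1 : ℤ)⟧) B =
        bracket (T.obj₂⟦(1 : ℤ)⟧) B at h
      have b₁ := bracket_mul_card_mul_bracket_shift hvan T.obj₁ B
      have b₂ := bracket_mul_card_mul_bracket_shift hvan T.obj₂ B
      have b₃ := bracket_mul_card_mul_bracket_shift hvan T.obj₃ B
      rw [e₁] at b₁
      rw [e₂] at b₂
      rw [e₃] at b₃
      push_cast at b₁ b₂ b₃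
      rw [← h] at b₂
      exact bracket_step b₁ b₂ b₃
  obtain ⟨N₁, h₁⟩ := hvan T.obj₁ B
  obtain ⟨N₂, h₂⟩ := hvan T.obj₂ B
  obtain ⟨N₃, h₃⟩ := hvan T.obj₃ B
  exact key (N₁ + N₂ + N₃) T hT (fun i hi => h₁ i (by omega)) (fun i hi => h₂ i (by omega))
    (fun i hi => h₃ i (by omega))

/-- Counting along the long exact sequence of `Hom(A, -)`. -/
theorem card_range_rightComp_mul_bracket (T : Triangle C) (hT : T ∈ distTriang C) (A : C) :
    (Nat.card (Preadditive.rightComp (A⟦(1 : ℤ)⟧) T.mor₃).range : ℚ) *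
      bracket A T.obj₁ * bracket A T.obj₃ = bracket A T.obj₂ := by
  have step (T : Triangle C) (hT : T ∈ distTriang C) (A : C) : Nat.card (A ⟶ T.obj₂) =
      Nat.card (Preadditive.rightComp A T.mor₁).range *
        Nat.card (Preadditive.rightComp A T.rotate.mor₁).range := by
    rw [← card_ker_mul_card_range (Preadditive.rightComp A T.mor₂)]
    have : (Preadditive.rightComp A T.mor₂).ker = (Preadditive.rightComp A T.mor₁).range := by
      ext x
      constructor
      · intro hx
        obtain ⟨y, hy⟩ := Triangle.coyoneda_exact₂ _ hT x hx
        exact ⟨y, hy.symm⟩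
      · rintro ⟨y, rfl⟩
        change (y ≫ T.mor₁) ≫ T.mor₂ = 0
        rw [Category.assoc, comp_distTriang_mor_zero₁₂ _ hT, comp_zero]
    rw [this]
    rfl
  -- Three rotations give the shifted triangle up to signs, which do not change the order of an
  -- image. This links the sequence for `A[1]` with that for `A`.
  have hshift (T : Triangle C) (A : C) :
      Nat.card (Preadditive.rightComp (A⟦(1 : ℤ)⟧) T.rotate.rotate.rotate.mor₁).range =
        Nat.card (Preadditive.rightComp A T.mor₁).range := by
    symm
    refine Nat.card_eq_of_bijective (fun x => ⟨-x.1⟦(1 : ℤ)⟧', ?_⟩) ⟨?_, ?_⟩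
    · obtain ⟨_, y, rfl⟩ := x
      exact ⟨y⟦(1 : ℤ)⟧', (by simp : y⟦(1 : ℤ)⟧' ≫ (-T.mor₁⟦(1 : ℤ)⟧') =
        -(y ≫ T.mor₁)⟦(1 : ℤ)⟧')⟩
    · rintro ⟨x, hx⟩ ⟨y, hy⟩ hxy
      have := neg_injective (congrArg Subtype.val hxy)
      exact Subtype.ext ((shiftFunctor C (1 : ℤ)).map_injective this)
    · rintro ⟨_, y, rfl⟩
      obtain ⟨y, rfl⟩ := (shiftFunctor C (1 : ℤ)).map_surjective y
      exact ⟨⟨y ≫ T.mor₁, y, rfl⟩, Subtype.ext (by simp : -(y ≫ T.mor₁)⟦(1 : ℤ)⟧' =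
        y⟦(1 : ℤ)⟧' ≫ (-T.mor₁⟦(1 : ℤ)⟧'))⟩
  have key (N : ℕ) : ∀ A : C,
      (∀ i : ℕ, N < i → Subsingleton (A⟦(i : ℤ)⟧ ⟶ T.obj₁)) →
      (∀ i : ℕ, N < i → Subsingleton (A⟦(i : ℤ)⟧ ⟶ T.obj₂)) →
      (∀ i : ℕ, N < i → Subsingleton (A⟦(i : ℤ)⟧ ⟶ T.obj₃)) →
      (Nat.card (Preadditive.rightComp (A⟦(1 : ℤ)⟧) T.mor₃).range : ℚ) *
        bracket A T.obj₁ * bracket A T.obj₃ = bracket A T.obj₂ := by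
    have hT₁ := rot_of_distTriang _ hT
    have hT₂ := rot_of_distTriang _ hT₁
    induction N with
    | zero =>
      intro A h₁ h₂ h₃
      have := h₃ 1 one_pos
      have h : Nat.card (A⟦(1 : ℤ)⟧ ⟶ T.obj₃) = 1 := Nat.card_unique
      have h' := step _ hT₁ (A⟦(1 : ℤ)⟧)
      change Nat.card (A⟦(1 : ℤ)⟧ ⟶ T.obj₃) = _ *
        Nat.card (Preadditive.rightComp (A⟦(1 : ℤ)⟧) T.mor₃).range at h'
      rw [h, eq_comm, mul_eq_one] at h'
      rw [bracket_eq_prod h₁, bracket_eq_prod h₂, bracket_eq_prod h₃, h'.2]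
      simp
    | succ N ih =>
      intro A h₁ h₂ h₃
      have h := ih (A⟦(1 : ℤ)⟧) (subsingleton_shift_hom h₁) (subsingleton_shift_hom h₂)
        (subsingleton_shift_hom h₃)
      have e₂ := step _ hT (A⟦(1 : ℤ)⟧)
      have e₃ := step _ hT₁ (A⟦(1 : ℤ)⟧)
      have e₁ := step _ hT₂ (A⟦(1 : ℤ)⟧⟦(1 : ℤ)⟧)
      rw [hshift] at e₁
      change Nat.card (A⟦(1 : ℤ)⟧ ⟶ T.obj₃) = _ *
        Nat.card (Preadditive.rightComp (A⟦(1 : ℤ)⟧) T.mor₃).range at e₃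
      change Nat.card (A⟦(1 : ℤ)⟧⟦(1 : ℤ)⟧ ⟶ T.obj₁⟦(1 : ℤ)⟧) =
        Nat.card (Preadditive.rightComp (A⟦(1 : ℤ)⟧⟦(1 : ℤ)⟧) T.mor₃).range * _ at e₁
      rw [← Nat.card_congr (Functor.FullyFaithful.ofFullyFaithful
        (shiftFunctor C (1 : ℤ))).homEquiv] at e₁
      have b₁ := bracket_mul_card_mul_bracket_shift hvan A T.obj₁
      have b₂ := bracket_mul_card_mul_bracket_shift hvan A T.obj₂
      have b₃ := bracket_mul_card_mul_bracket_shift hvan A T.obj₃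
      rw [e₁] at b₁
      rw [e₂] at b₂
      rw [e₃] at b₃
      push_cast at b₁ b₂ b₃
      rw [← h, mul_right_comm (Nat.cast _)] at b₂
      rw [mul_right_comm]
      exact bracket_step b₃ b₂ b₁
  obtain ⟨N₁, h₁⟩ := hvan A T.obj₁
  obtain ⟨N₂, h₂⟩ := hvan A T.obj₂
  obtain ⟨N₃, h₃⟩ := hvan A T.obj₃
  exact key (N₁ + N₂ + N₃) A (fun i hi => h₁ i (by omega)) (fun i hi => h₂ i (by omega))
    (fun i hi => h₃ i (by omega))

end Vanishing

end Bracket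

/-! ### Triangles, cones and orbits -/

section Triangles

variable {C : Type u} [Category.{v} C] [Preadditive C] [HasZeroObject C] [HasShift C ℤ]
  [∀ n : ℤ, (shiftFunctor C n).Additive] [Pretriangulated C]

theorem distinguished_of_iso {X X' L L' Y Y' : C} {f : X ⟶ L} {g : L ⟶ Y} {h : Y ⟶ X⟦(1 : ℤ)⟧}
    (hT : Triangle.mk f g h ∈ distTriang C) (a : X' ≅ X) (b : L' ≅ L) (c : Y' ≅ Y) :
    Triangle.mk (a.hom ≫ f ≫ b.inv) (b.hom ≫ g ≫ c.inv) (c.hom ≫ h ≫ a.inv⟦(1 : ℤ)⟧') ∈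
      distTriang C :=
  isomorphic_distinguished _ hT _ (Triangle.isoMk _ _ a b c
    (show (a.hom ≫ f ≫ b.inv) ≫ b.hom = a.hom ≫ f by simp)
    (show (b.hom ≫ g ≫ c.inv) ≫ c.hom = b.hom ≫ g by simp)
    (show (c.hom ≫ h ≫ a.inv⟦(1 : ℤ)⟧') ≫ a.hom⟦(1 : ℤ)⟧' = c.hom ≫ h by
      simp [← Functor.map_comp]))

theorem distinguished_comp_iso {X L Y Y' : C} {f : X ⟶ L} {g : L ⟶ Y} {h : Y ⟶ X⟦(1 : ℤ)⟧}
    (hT : Triangle.mk f g h ∈ distTriang C) (c : Y ≅ Y') :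
    Triangle.mk f (g ≫ c.hom) (c.inv ≫ h) ∈ distTriang C := by
  simpa using distinguished_of_iso hT (Iso.refl _) (Iso.refl _) c.symm

section Morphisms

variable {X X' L L' Y Y' : C} {f : X ⟶ L} {g : L ⟶ Y} {h : Y ⟶ X⟦(1 : ℤ)⟧}
  {f' : X' ⟶ L'} {g' : L' ⟶ Y'} {h' : Y' ⟶ X'⟦(1 : ℤ)⟧}
  (hT : Triangle.mk f g h ∈ distTriang C) (hT' : Triangle.mk f' g' h' ∈ distTriang C)
include hT hT'

theorem exists_iso₃ (a : X ≅ X') (b : L ≅ L') (comm : f ≫ b.hom = a.hom ≫ f') :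
    ∃ c : Y ≅ Y', g ≫ c.hom = b.hom ≫ g' ∧ h ≫ a.hom⟦(1 : ℤ)⟧' = c.hom ≫ h' := by
  obtain ⟨c : Y ⟶ Y', h₁, h₂⟩ :=
    complete_distinguished_triangle_morphism _ _ hT hT' a.hom b.hom comm
  have : IsIso c := isIso₃_of_isIso₁₂
    (Triangle.homMk (Triangle.mk f g h) (Triangle.mk f' g' h') a.hom b.hom c comm h₁ h₂) hT hT'
    (Iso.isIso_hom a) (Iso.isIso_hom b)
  exact ⟨asIso c, h₁, h₂⟩

theorem exists_iso₁ (b : L ≅ L') (c : Y ≅ Y') (comm : g ≫ c.hom = b.hom ≫ g') :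
    ∃ a : X ≅ X', f ≫ b.hom = a.hom ≫ f' ∧ h ≫ a.hom⟦(1 : ℤ)⟧' = c.hom ≫ h' := by
  obtain ⟨a : X ⟶ X', h₁, h₂⟩ :=
    complete_distinguished_triangle_morphism₁ _ _ hT hT' b.hom c.hom comm
  have : IsIso a := isIso₁_of_isIso₂₃
    (Triangle.homMk (Triangle.mk f g h) (Triangle.mk f' g' h') a b.hom c.hom h₁ comm h₂) hT hT'
    (Iso.isIso_hom b) (Iso.isIso_hom c)
  exact ⟨asIso a, h₁, h₂⟩

theorem exists_iso₂ (a : X ≅ X') (c : Y ≅ Y') (comm : h ≫ a.hom⟦(1 : ℤ)⟧' = c.hom ≫ h') :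
    ∃ b : L ≅ L', f ≫ b.hom = a.hom ≫ f' ∧ g ≫ c.hom = b.hom ≫ g' := by
  obtain ⟨b : L ⟶ L', h₁, h₂⟩ :=
    complete_distinguished_triangle_morphism₂ _ _ hT hT' a.hom c.hom comm
  have : IsIso b := isIso₂_of_isIso₁₃
    (Triangle.homMk (Triangle.mk f g h) (Triangle.mk f' g' h') a.hom b c.hom h₁ h₂ comm) hT hT'
    (Iso.isIso_hom a) (Iso.isIso_hom c)
  exact ⟨asIso b, h₁, h₂⟩

end Morphisms

theorem mem_homWithCone_iff {X L Y Y' : C} {f : X ⟶ L} {g : L ⟶ Y'} {h : Y' ⟶ X⟦(1 : ℤ)⟧}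
    (hT : Triangle.mk f g h ∈ distTriang C) : f ∈ homWithCone X L Y ↔ Nonempty (Y' ≅ Y) := by
  constructor
  · rintro ⟨g', h', hT'⟩
    obtain ⟨c, -⟩ := exists_iso₃ hT hT' (Iso.refl _) (Iso.refl _) (by simp)
    exact ⟨c⟩
  · rintro ⟨e⟩
    exact ⟨g ≫ e.hom, e.inv ≫ h, distinguished_comp_iso hT e⟩

theorem mem_homWithCone_shift_iff {X L Y : C} {g : L ⟶ Y} :
    g ∈ homWithCone L Y (X⟦(1 : ℤ)⟧) ↔
      ∃ (f : X ⟶ L) (h : Y ⟶ X⟦(1 : ℤ)⟧), Triangle.mk f g h ∈ distTriang C := by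
  constructor
  · rintro ⟨h, k, hT⟩
    -- The sign compensates the one introduced by rotation.
    refine ⟨(shiftFunctor C (1 : ℤ)).preimage (-k), h, ?_⟩
    rw [rotate_distinguished_triangle]
    have : -((shiftFunctor C (1 : ℤ)).preimage (-k))⟦(1 : ℤ)⟧' = k := by simp
    rw [← this] at hT
    exact hT
  · rintro ⟨f, h, hT⟩
    exact ⟨h, _, rot_of_distTriang _ hT⟩

theorem card_homWithCone_congr {X X' L L' Y Y' : C} (a : X ≅ X') (b : L ≅ L') (c : Y ≅ Y') :
    Nat.card (homWithCone X L Y) = Nat.card (homWithCone X' L' Y') := by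
  have key {X X' L L' Y Y' : C} (a : X ≅ X') (b : L ≅ L') (c : Y ≅ Y') (f : X ⟶ L) :
      f ∈ homWithCone X L Y → a.homCongr b f ∈ homWithCone X' L' Y' := by
    rintro ⟨g, h, hT⟩
    exact ⟨_, _, distinguished_of_iso hT a.symm b.symm c.symm⟩
  refine Nat.card_congr ((a.homCongr b).subtypeEquiv fun f => ⟨key a b c f, fun hf => ?_⟩)
  simpa using key a.symm b.symm c.symm _ hf

/-- The orbit of a triangle. -/
def Tri.orbit {X Y L : C} (t : Tri X Y L) : TriOrbit X Y L := Quotient.mk (triSetoid X Y L) t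

theorem Tri.orbit_eq_iff {X Y L : C} {s t : Tri X Y L} :
    s.orbit = t.orbit ↔ (triSetoid X Y L).r s t :=
  Quotient.eq

/-- Any two completions of `f` to a triangle differ by an automorphism of `Y`, so the other two maps
carry no further information. -/
theorem Tri.orbit_eq_iff_f {X Y L : C} {s t : Tri X Y L} :
    s.orbit = t.orbit ↔ ∃ a : X ≅ X, t.f = a.hom ≫ s.f := by
  rw [Tri.orbit_eq_iff]
  constructor
  · rintro ⟨a, c, h, -⟩
    exact ⟨a, h⟩
  · rintro ⟨a, h⟩
    obtain ⟨c, h₂, h₃⟩ := exists_iso₃ t.dist s.dist a (Iso.refl L) (by simpa using h)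
    refine ⟨a, c, h, ?_, ?_⟩
    · rw [Iso.eq_comp_inv, h₂]
      simp
    · rw [← reassoc_of% h₃, ← Functor.map_comp]
      simp

theorem Tri.orbit_eq_iff_g {X Y L : C} {s t : Tri X Y L} :
    s.orbit = t.orbit ↔ ∃ c : Y ≅ Y, t.g = s.g ≫ c.inv := by
  rw [Tri.orbit_eq_iff]
  constructor
  · rintro ⟨a, c, -, h, -⟩
    exact ⟨c, h⟩
  · rintro ⟨c, h⟩
    obtain ⟨a, h₁, h₂⟩ := exists_iso₁ t.dist s.dist (Iso.refl L) c (by simp [h])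
    refine ⟨a, c, by simpa using h₁, h, ?_⟩
    rw [← reassoc_of% h₂, ← Functor.map_comp]
    simp

theorem HasIsoPart.of_orbit_eq {X Y L A : C} {s t : Tri X Y L} (hst : s.orbit = t.orbit)
    (hs : HasIsoPart s.h A) : HasIsoPart t.h A := by
  obtain ⟨a, c, -, -, h⟩ := Tri.orbit_eq_iff.1 hst
  obtain ⟨Y₂, Z₂, e, e', r, hr, hs⟩ := hs
  exact ⟨Y₂, Z₂, c ≪≫ e, (shiftFunctor C (1 : ℤ)).mapIso a ≪≫ e', r, hr, by simp [h, hs]⟩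

end Triangles

/-! ### The Hall number as a count of morphisms -/

section HallNumber

variable {C : Type u} [Category.{v} C] [Preadditive C] [HasZeroObject C] [HasShift C ℤ]
  [∀ n : ℤ, (shiftFunctor C n).Additive] [Pretriangulated C]
  [∀ X Y : C, Finite (X ⟶ Y)]

instance finite_aut (X : C) : Finite (Aut X) :=
  Finite.of_injective (fun a : Aut X => (a.hom : X ⟶ X)) fun _ _ h => Iso.ext h

instance finite_tri (X Y L : C) : Finite (Tri X Y L) :=
  Finite.of_injective (fun t => (t.f, t.g, t.h)) fun s t h => by
    simp only [Prod.mk.injEq] at h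
    exact Tri.ext h.1 h.2.1 h.2.2

instance finite_triOrbit (X Y L : C) : Finite (TriOrbit X Y L) :=
  inferInstanceAs (Finite (Quotient (triSetoid X Y L)))

theorem card_mul_of_card_fiber {G S : Type*} [Finite G] [Finite S] {n : ℕ} (F : G → S)
    (hF : Function.Surjective F) (h : ∀ b, Nat.card {a // F a = F b} = n) :
    Nat.card S * n = Nat.card G := by
  have := Fintype.ofFinite S
  have h' (s : S) : Nat.card {a // F a = s} = n := by
    obtain ⟨b, rfl⟩ := hF s
    exact h b
  rw [← Nat.card_congr (Equiv.sigmaFiberEquiv F), Nat.card_sigma, Finset.sum_congr rfl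
    fun x _ => h' x, Finset.sum_const, Finset.card_univ, smul_eq_mul,
    Nat.card_eq_fintype_card (α := S)]

/-- The chosen object may come from another triangle of the orbit, but the action changes `h` only
by isomorphisms. Existence excludes the default value `0`. -/
theorem isoPart_spec {X Y L : C} (t : Tri X Y L) :
    HasIsoPart t.h ((isoPart t.orbit)⟦(1 : ℤ)⟧) := by
  obtain ⟨B, hB⟩ := exists_hasIsoPart t.h
  obtain ⟨A, hA⟩ := hB.exists_isIsoPart
  have H : ∃ (A : C) (s : Tri X Y L), s.orbit = t.orbit ∧ IsIsoPart s.h A := ⟨A, t, rfl, hA⟩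
  have h : isoPart t.orbit = H.choose := dif_pos H
  obtain ⟨s, hs, hs'⟩ := H.choose_spec
  rw [h]
  exact hs'.hasIsoPart.of_orbit_eq hs

theorem card_hom_shift (X Y : C) :
    Nat.card (X⟦(1 : ℤ)⟧ ⟶ Y⟦(1 : ℤ)⟧) = Nat.card (X ⟶ Y) :=
  (Nat.card_congr (Functor.FullyFaithful.ofFullyFaithful (shiftFunctor C (1 : ℤ))).homEquiv).symm

theorem card_aut_shift (X : C) : Nat.card (Aut (X⟦(1 : ℤ)⟧)) = Nat.card (Aut X) :=
  (Nat.card_congr (Functor.FullyFaithful.ofFullyFaithful (shiftFunctor C (1 : ℤ))).isoEquiv).symm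

theorem card_aut_congr {X Y : C} (e : X ≅ Y) : Nat.card (Aut X) = Nat.card (Aut Y) :=
  Nat.card_congr (Iso.conjAut e).toEquiv

theorem card_aut_ne_zero (X : C) : (Nat.card (Aut X) : ℚ) ≠ 0 :=
  Nat.cast_ne_zero.2 Nat.card_pos.ne'

/-- Orbit counting in abstract form: `S` will be the set of morphisms `f` (or `g`), `G` the order of
the acting group and `r` the order of the image in the long exact sequence. -/
theorem hallNumber_eq_of_card_fiber {X Y L : C} {S : Type*} [Finite S]
    (cls : S → TriOrbit X Y L) {G r : ℚ} (hG : G ≠ 0)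
    (h : ∀ (t : Tri X Y L) (A : C), HasIsoPart t.h A →
      (Nat.card {s // cls s = t.orbit} : ℚ) * (Nat.card (Aut A) * r) =
        G * Nat.card (A ⟶ A)) :
    hallNumber X Y L = bracket X Y * (Nat.card S * r / G) := by
  have := Fintype.ofFinite (TriOrbit X Y L)
  have h' (α : TriOrbit X Y L) :
      (Nat.card (End (isoPart α)) : ℚ) / Nat.card (Aut (isoPart α)) =
        Nat.card {s // cls s = α} * (r / G) := by
    obtain ⟨t, rfl⟩ : ∃ t : Tri X Y L, t.orbit = α := Quotient.exists_rep α
    have := h t _ (isoPart_spec t)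
    rw [card_hom_shift, card_aut_shift] at this
    rw [div_eq_iff (card_aut_ne_zero _), mul_right_comm, mul_div_assoc', eq_div_iff hG,
      mul_comm _ G]
    exact this.symm.trans (by ring)
  rw [hallNumber, finsum_eq_sum_of_fintype, Finset.sum_congr rfl fun α _ => h' α,
    ← Finset.sum_mul, ← Nat.cast_sum, ← Nat.card_sigma,
    Nat.card_congr (Equiv.sigmaFiberEquiv cls), mul_div_assoc]

theorem isIso_of_isIso_shift_map {X Y : C} {f : X ⟶ Y} (h : IsIso (f⟦(1 : ℤ)⟧')) : IsIso f :=
  isIso_of_reflects_iso f (shiftFunctor C (1 : ℤ))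

section Local

variable (hloc : ∀ X : C, Indecomposable X → IsLocalRing (End X))
include hloc

/-- By exactness `(a - 1)f = 0` means that `a[1] - 1 = φh` for some `φ`. Each value `φh` comes from
as many `φ` as the kernel has elements. -/
theorem card_stabilizer_f {X Y L A : C} (t : Tri X Y L) (hA : HasIsoPart t.h A) :
    Nat.card {a : Aut X // a.hom ≫ t.f = t.f} * Nat.card (A ⟶ A) =
      Nat.card (Aut A) * Nat.card (Preadditive.rightComp (X⟦(1 : ℤ)⟧) t.h).range := by
  let ψ := Preadditive.rightComp (X⟦(1 : ℤ)⟧) t.h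
  have hstab : Nat.card {a : Aut X // a.hom ≫ t.f = t.f} =
      Nat.card {x : X⟦(1 : ℤ)⟧ ⟶ X⟦(1 : ℤ)⟧ // x - 𝟙 _ ∈ ψ.range ∧ IsIso x} := by
    refine Nat.card_eq_of_bijective (fun a => ⟨a.1.hom⟦(1 : ℤ)⟧', ?_,
      Iso.isIso_hom ((shiftFunctor C (1 : ℤ)).mapIso a.1)⟩) ⟨?_, ?_⟩
    · obtain ⟨y, hy⟩ := Triangle.coyoneda_exact₁ _ t.dist (a.1.hom⟦(1 : ℤ)⟧' - 𝟙 _)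
        (show (a.1.hom⟦(1 : ℤ)⟧' - 𝟙 _) ≫ t.f⟦(1 : ℤ)⟧' = 0 by
          rw [Preadditive.sub_comp, ← Functor.map_comp, a.2, Category.id_comp, sub_self])
      exact ⟨y, hy.symm⟩
    · intro a b hab
      exact Subtype.ext (Iso.ext ((shiftFunctor C (1 : ℤ)).map_injective
        (congrArg Subtype.val hab)))
    · rintro ⟨x, ⟨y, hy⟩, hx⟩
      obtain ⟨x, rfl⟩ := (shiftFunctor C (1 : ℤ)).map_surjective x
      have := isIso_of_isIso_shift_map hx
      refine ⟨⟨asIso x, (shiftFunctor C (1 : ℤ)).map_injective ?_⟩, rfl⟩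
      have h₁ := congrArg (· ≫ t.f⟦(1 : ℤ)⟧') hy
      have h₂ : t.h ≫ t.f⟦(1 : ℤ)⟧' = 0 := comp_distTriang_mor_zero₃₁ _ t.dist
      have h₃ : (y ≫ t.h) ≫ t.f⟦(1 : ℤ)⟧' = 0 := by rw [Category.assoc, h₂, comp_zero]
      have h₄ := h₁.symm.trans h₃
      simpa [Preadditive.sub_comp, sub_eq_zero] using h₄
  have h₁ := hA.card_isIso hloc
  have h₂ := card_subtype_add_apply ψ (𝟙 _) IsIso
  have h₃ := card_ker_mul_card_range ψ
  rw [hstab]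
  refine Nat.eq_of_mul_eq_mul_left (Nat.card_pos (α := ψ.ker)) ?_
  rw [← mul_assoc, ← h₂, mul_left_comm, h₃]
  exact h₁

theorem card_stabilizer_g {X Y L A : C} (t : Tri X Y L) (hA : HasIsoPart t.h A) :
    Nat.card {c : Aut Y // t.g ≫ c.hom = t.g} * Nat.card (A ⟶ A) =
      Nat.card (Aut A) * Nat.card (Preadditive.leftComp Y t.h).range := by
  let ψ := Preadditive.leftComp Y t.h
  have hstab : Nat.card {c : Aut Y // t.g ≫ c.hom = t.g} =
      Nat.card {x : Y ⟶ Y // x - 𝟙 _ ∈ ψ.range ∧ IsIso x} := by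
    refine Nat.card_eq_of_bijective (fun a => ⟨a.1.hom, ?_, Iso.isIso_hom a.1⟩) ⟨?_, ?_⟩
    · obtain ⟨y, hy⟩ := Triangle.yoneda_exact₃ _ t.dist (a.1.hom - 𝟙 _)
        (show t.g ≫ (a.1.hom - 𝟙 _) = 0 by
          rw [Preadditive.comp_sub, a.2, Category.comp_id, sub_self])
      exact ⟨y, hy.symm⟩
    · intro a b hab
      exact Subtype.ext (Iso.ext (congrArg Subtype.val hab))
    · rintro ⟨x, ⟨y, hy⟩, hx⟩
      refine ⟨⟨asIso x, ?_⟩, rfl⟩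
      have h₁ := congrArg (t.g ≫ ·) hy
      have h₂ : t.g ≫ t.h = 0 := comp_distTriang_mor_zero₂₃ _ t.dist
      have h₃ : t.g ≫ t.h ≫ y = 0 := by rw [← Category.assoc, h₂, zero_comp]
      have h₄ := h₁.symm.trans h₃
      simpa [Preadditive.comp_sub, sub_eq_zero] using h₄
  have h₁ := hA.card_isIso hloc
  have h₂ := card_subtype_add_apply ψ (𝟙 _) IsIso
  have h₃ := card_ker_mul_card_range ψ
  rw [hstab]
  refine Nat.eq_of_mul_eq_mul_left (Nat.card_pos (α := ψ.ker)) ?_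
  rw [← mul_assoc, ← h₂, mul_left_comm, h₃]
  -- Here `1 + hφ` on `Y` is needed instead of `1 + φh` on `X[1]`; the two are invertible for the
  -- same `φ`, so both stabilizers see the same isomorphism part.
  simp only [isIso_id_add_comp_iff] at h₁
  exact h₁

variable (hvan : ∀ X Y : C, ∃ N : ℕ, ∀ i : ℕ, N < i → Subsingleton (X⟦(i : ℤ)⟧ ⟶ Y))
include hvan

theorem hallNumber_eq_homWithCone (X Y L : C) : hallNumber X Y L =
    Nat.card (homWithCone X L Y) * bracket X L / (Nat.card (Aut X) * bracket X X) := by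
  -- The completions are arbitrary: the orbit depends on `f` alone.
  choose g h hT using fun f : homWithCone X L Y => f.2
  let tri (f : homWithCone X L Y) : Tri X Y L := ⟨f.1, g f, h f, hT f⟩
  rw [hallNumber_eq_of_card_fiber (fun f => (tri f).orbit)
    (r := bracket X L / (bracket X X * bracket X Y)) (card_aut_ne_zero X)]
  · have := bracket_ne_zero hvan X Y
    have := bracket_ne_zero hvan X X
    have := card_aut_ne_zero X
    field_simp
  intro t A hA
  have hr : bracket X L / (bracket X X * bracket X Y) =
      Nat.card (Preadditive.rightComp (X⟦(1 : ℤ)⟧) t.h).range := by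
    have := card_range_rightComp_mul_bracket hvan _ t.dist X
    rw [div_eq_iff (mul_ne_zero (bracket_ne_zero hvan X X) (bracket_ne_zero hvan X Y)),
      ← mul_assoc]
    exact this.symm
  have hfib : Nat.card {f // (tri f).orbit = t.orbit} *
      Nat.card {a : Aut X // a.hom ≫ t.f = t.f} = Nat.card (Aut X) := by
    refine card_mul_of_card_fiber (fun a => ⟨⟨a.hom ≫ t.f, ?_⟩, ?_⟩) ?_ ?_
    · exact ⟨t.g, t.h ≫ a.inv⟦(1 : ℤ)⟧', by
        simpa using distinguished_of_iso t.dist a (Iso.refl L) (Iso.refl Y)⟩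
    · exact (Tri.orbit_eq_iff_f.2 ⟨a, rfl⟩).symm
    · rintro ⟨f, hf⟩
      obtain ⟨a, ha⟩ := Tri.orbit_eq_iff_f.1 hf.symm
      exact ⟨a, Subtype.ext (Subtype.ext ha.symm)⟩
    · intro b
      refine Nat.card_congr ((Equiv.mulRight b⁻¹).subtypeEquiv fun a => ?_)
      have : a.hom ≫ t.f = b.hom ≫ t.f ↔ (b.inv ≫ a.hom) ≫ t.f = t.f := by
        rw [Category.assoc]
        exact (Iso.inv_comp_eq b).symm
      exact Iff.trans ⟨fun h => congrArg (fun x => x.1.1) h, fun h => Subtype.ext (Subtype.ext h)⟩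
        this
  have := card_stabilizer_f hloc t hA
  rw [hr]
  norm_cast
  rw [← this, ← mul_assoc, hfib]

theorem hallNumber_eq_homWithCone_shift (X Y L : C) : hallNumber X Y L =
    Nat.card (homWithCone L Y (X⟦(1 : ℤ)⟧)) * bracket L Y /
      (Nat.card (Aut Y) * bracket Y Y) := by
  choose f h hT using fun g : homWithCone L Y (X⟦(1 : ℤ)⟧) => mem_homWithCone_shift_iff.1 g.2
  let tri (g : homWithCone L Y (X⟦(1 : ℤ)⟧)) : Tri X Y L := ⟨f g, g.1, h g, hT g⟩
  rw [hallNumber_eq_of_card_fiber (fun f => (tri f).orbit)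
    (r := bracket L Y / (bracket X Y * bracket Y Y)) (card_aut_ne_zero Y)]
  · have := bracket_ne_zero hvan X Y
    have := bracket_ne_zero hvan Y Y
    have := card_aut_ne_zero Y
    field_simp
  intro t A hA
  have hr : bracket L Y / (bracket X Y * bracket Y Y) =
      Nat.card (Preadditive.leftComp Y t.h).range := by
    have := card_range_leftComp_mul_bracket hvan _ t.dist Y
    rw [div_eq_iff (mul_ne_zero (bracket_ne_zero hvan X Y) (bracket_ne_zero hvan Y Y)),
      ← mul_assoc]
    exact this.symm
  have hfib : Nat.card {f // (tri f).orbit = t.orbit} *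
      Nat.card {c : Aut Y // t.g ≫ c.hom = t.g} = Nat.card (Aut Y) := by
    refine card_mul_of_card_fiber (fun c => ⟨⟨t.g ≫ c.hom, ?_⟩, ?_⟩) ?_ ?_
    · exact mem_homWithCone_shift_iff.2 ⟨t.f, c.inv ≫ t.h, distinguished_comp_iso t.dist c⟩
    · exact (Tri.orbit_eq_iff_g.2 ⟨c.symm, rfl⟩).symm
    · rintro ⟨f, hf⟩
      obtain ⟨c, hc⟩ := Tri.orbit_eq_iff_g.1 hf.symm
      exact ⟨c.symm, Subtype.ext (Subtype.ext hc.symm)⟩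
    · intro b
      refine Nat.card_congr ((Equiv.mulLeft b⁻¹).subtypeEquiv fun a => ?_)
      have : t.g ≫ a.hom = t.g ≫ b.hom ↔ t.g ≫ a.hom ≫ b.inv = t.g := by
        rw [← Category.assoc]
        exact (Iso.comp_inv_eq b).symm
      exact Iff.trans ⟨fun h => congrArg (fun x => x.1.1) h, fun h => Subtype.ext (Subtype.ext h)⟩
        this
  have := card_stabilizer_g hloc t hA
  rw [hr]
  norm_cast
  rw [← this, ← mul_assoc, hfib]

theorem hallNumber_congr {X X' Y Y' L L' : C} (a : X ≅ X') (c : Y ≅ Y') (b : L ≅ L') :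
    hallNumber X Y L = hallNumber X' Y' L' := by
  rw [hallNumber_eq_homWithCone hloc hvan, hallNumber_eq_homWithCone hloc hvan,
    card_homWithCone_congr a b c, bracket_congr a b, bracket_congr a a, card_aut_congr a]

theorem finite_setOf_hallNumber_ne_zero (X Y : C) :
    {ℓ : IsoClass C | hallNumber X Y ℓ.out ≠ 0}.Finite := by
  -- The object `L` is determined up to isomorphism by `h`, which has finitely many values.
  choose L f g hT using fun h : Y ⟶ X⟦(1 : ℤ)⟧ => distinguished_cocone_triangle₂ h
  refine (Set.finite_range fun h => isoClass (L h)).subset fun ℓ hℓ => ?_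
  rw [Set.mem_ofPred_eq, hallNumber_eq_homWithCone hloc hvan] at hℓ
  have : Nat.card (homWithCone X ℓ.out Y) ≠ 0 := fun h0 => hℓ (by simp [h0])
  obtain ⟨⟨f', g', h, hT'⟩⟩ := (Nat.card_ne_zero.1 this).1
  refine ⟨h, ?_⟩
  rw [← Quotient.out_eq ℓ]
  obtain ⟨e, -⟩ := exists_iso₂ (hT h) hT' (Iso.refl X) (Iso.refl Y) (by simp)
  exact Quotient.sound ⟨e⟩

end Local

end HallNumber

/-! ### Associativity through octahedra -/

section Associativity

variable {C : Type u} [Category.{v} C] [Preadditive C] [HasZeroObject C] [HasShift C ℤ]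
  [∀ n : ℤ, (shiftFunctor C n).Additive] [Pretriangulated C]

theorem mem_homWithCone_shift_iff_nonempty_iso {X X' L Y : C} {f : X' ⟶ L} {g : L ⟶ Y}
    {h : Y ⟶ X'⟦(1 : ℤ)⟧} (hT : Triangle.mk f g h ∈ distTriang C) :
    g ∈ homWithCone L Y (X⟦(1 : ℤ)⟧) ↔ Nonempty (X' ≅ X) := by
  rw [mem_homWithCone_shift_iff]
  constructor
  · rintro ⟨f', h', hT'⟩
    obtain ⟨a, -⟩ := exists_iso₁ hT hT' (Iso.refl _) (Iso.refl _) (by simp)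
    exact ⟨a⟩
  · rintro ⟨e⟩
    refine ⟨e.inv ≫ f, h ≫ e.hom⟦(1 : ℤ)⟧', ?_⟩
    simpa using distinguished_of_iso hT e.symm (Iso.refl _) (Iso.refl _)

theorem nonempty_iso_biprod_of_comp [IsTriangulated C] {A B D C₁ C₂ K : C} {u : A ⟶ B}
    {a : B ⟶ C₁} {b : C₁ ⟶ A⟦(1 : ℤ)⟧} (h₁ : Triangle.mk u a b ∈ distTriang C)
    {v : B ⟶ D} {c : D ⟶ C₂} {d : C₂ ⟶ B⟦(1 : ℤ)⟧} (h₂ : Triangle.mk v c d ∈ distTriang C)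
    {k : D ⟶ K} {l : K ⟶ A⟦(1 : ℤ)⟧} (h₃ : Triangle.mk (u ≫ v) k l ∈ distTriang C)
    (h : d ≫ a⟦(1 : ℤ)⟧' = 0) : Nonempty (K ≅ C₁ ⊞ C₂) := by
  obtain ⟨e, -⟩ := exists_iso_binaryBiproduct_of_distTriang _
    (Triangulated.someOctahedron rfl h₁ h₂ h₃).mem h
  exact ⟨e⟩

theorem shift_one_distinguished {X L Y : C} {f : X ⟶ L} {g : L ⟶ Y} {h : Y ⟶ X⟦(1 : ℤ)⟧}
    (hT : Triangle.mk f g h ∈ distTriang C) :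
    Triangle.mk (f⟦(1 : ℤ)⟧') (g⟦(1 : ℤ)⟧') (-h⟦(1 : ℤ)⟧') ∈ distTriang C := by
  have hT₃ : Triangle.mk (-f⟦(1 : ℤ)⟧') (-g⟦(1 : ℤ)⟧') (-h⟦(1 : ℤ)⟧') ∈ distTriang C :=
    rot_of_distTriang _ (rot_of_distTriang _ (rot_of_distTriang _ hT))
  simpa using distinguished_of_iso hT₃ (Iso.refl _) (-Iso.refl _) (Iso.refl _)

variable [∀ X Y : C, Finite (X ⟶ Y)]
  (hloc : ∀ X : C, Indecomposable X → IsLocalRing (End X))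

include hloc in
/-- In a commutative diagram built from the triangles over `m = v i` and `y = p u`, the cone of
`u` is the shifted cone of `v`. -/
theorem nonempty_iso_cone_of_compatible [IsTriangulated C] {Z M L L' Y Cu Cv : C} {m : Z ⟶ M}
    {p : M ⟶ L} {q : L ⟶ Z⟦(1 : ℤ)⟧} (h₁ : Triangle.mk m p q ∈ distTriang C) {i : L' ⟶ M}
    {y : M ⟶ Y} {j : Y ⟶ L'⟦(1 : ℤ)⟧} (h₂ : Triangle.mk i y j ∈ distTriang C) {u : L ⟶ Y}
    (hu : p ≫ u = y) {v : Z ⟶ L'} (hv : v ≫ i = m) (huv : u ≫ j = q ≫ v⟦(1 : ℤ)⟧')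
    {a : Y ⟶ Cu} {b : Cu ⟶ L⟦(1 : ℤ)⟧} (h₃ : Triangle.mk u a b ∈ distTriang C)
    {c : L' ⟶ Cv} {d : Cv ⟶ Z⟦(1 : ℤ)⟧} (h₄ : Triangle.mk v c d ∈ distTriang C) :
    Nonempty (Cu ≅ Cv⟦(1 : ℤ)⟧) := by
  -- The cone `K` of `uj = qv[1]` is computed by two octahedra. Both connecting maps vanish, so `K`
  -- is `Cu ⊞ M[1]` and also `M[1] ⊞ Cv[1]`; then `M[1]` is cancelled.
  obtain ⟨K, k, l, hK⟩ := distinguished_cocone_triangle (u ≫ j)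
  have hj : Triangle.mk j (-i⟦(1 : ℤ)⟧') (-y⟦(1 : ℤ)⟧') ∈ distTriang C :=
    rot_of_distTriang _ (rot_of_distTriang _ h₂)
  have hua : u ≫ a = 0 := comp_distTriang_mor_zero₁₂ _ h₃
  have hdv : d ≫ v⟦(1 : ℤ)⟧' = 0 := comp_distTriang_mor_zero₃₁ _ h₄
  obtain ⟨e₁⟩ := nonempty_iso_biprod_of_comp h₃ hj hK (by
    rw [Preadditive.neg_comp, ← Functor.map_comp, ← hu, Category.assoc, hua]
    simp)
  have hq : Triangle.mk q (-m⟦(1 : ℤ)⟧') (-p⟦(1 : ℤ)⟧') ∈ distTriang C :=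
    rot_of_distTriang _ (rot_of_distTriang _ h₁)
  rw [huv] at hK
  obtain ⟨e₂⟩ := nonempty_iso_biprod_of_comp hq (shift_one_distinguished h₄) hK (by
    rw [Functor.map_neg, Preadditive.neg_comp_neg, ← Functor.map_comp, ← hv, Functor.map_comp _ v,
      reassoc_of% hdv]
    simp)
  exact nonempty_iso_of_biprod_iso hloc _ (biprod.braiding _ _ ≪≫ e₁.symm ≪≫ e₂)

/-- Lifts of `y` and `m` chosen independently need not satisfy `uj = qw`. Extending `(1, u)` to a
morphism of the rotated triangles supplies a `w` that does. -/
theorem exists_compatible {Z M L L' Y : C} {m : Z ⟶ M}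
    {p : M ⟶ L} {q : L ⟶ Z⟦(1 : ℤ)⟧} (h₁ : Triangle.mk m p q ∈ distTriang C) {i : L' ⟶ M}
    {y : M ⟶ Y} {j : Y ⟶ L'⟦(1 : ℤ)⟧} (h₂ : Triangle.mk i y j ∈ distTriang C)
    (hmy : m ≫ y = 0) : ∃ (u : L ⟶ Y) (w : Z⟦(1 : ℤ)⟧ ⟶ L'⟦(1 : ℤ)⟧),
      p ≫ u = y ∧ w ≫ i⟦(1 : ℤ)⟧' = m⟦(1 : ℤ)⟧' ∧ u ≫ j = q ≫ w := by
  obtain ⟨u : L ⟶ Y, hu : y = p ≫ u⟩ := Triangle.yoneda_exact₂ _ h₁ y hmy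
  obtain ⟨w : Z⟦(1 : ℤ)⟧ ⟶ L'⟦(1 : ℤ)⟧, hw₁, hw₂⟩ := complete_distinguished_triangle_morphism _ _
    (rot_of_distTriang _ h₁) (rot_of_distTriang _ h₂) (𝟙 M) u
    (show p ≫ u = 𝟙 M ≫ y by rw [hu, Category.id_comp])
  have hw₂ : (-m⟦(1 : ℤ)⟧') ≫ (𝟙 M)⟦(1 : ℤ)⟧' = w ≫ (-i⟦(1 : ℤ)⟧') := hw₂
  refine ⟨u, w, hu.symm, ?_, hw₁.symm⟩
  rw [CategoryTheory.Functor.map_id, Category.comp_id, Preadditive.comp_neg, neg_inj] at hw₂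
  exact hw₂.symm

variable (hvan : ∀ X Y : C, ∃ N : ℕ, ∀ i : ℕ, N < i → Subsingleton (X⟦(i : ℤ)⟧ ⟶ Y))

include hloc hvan in
-- Starting from one compatible pair, all lifts are `u₀ + qg` and `w₀ + gj` with `g : Z[1] → Y`. The
-- same `g` gives a compatible pair, hence matching cones; the long exact sequences evaluate the
-- overcounting.
theorem bracket_mul_card_fiber_eq [IsTriangulated C] {Z M L L' Y : C} {m : Z ⟶ M}
    {p : M ⟶ L} {q : L ⟶ Z⟦(1 : ℤ)⟧} (h₁ : Triangle.mk m p q ∈ distTriang C) {i : L' ⟶ M}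
    {y : M ⟶ Y} {j : Y ⟶ L'⟦(1 : ℤ)⟧} (h₂ : Triangle.mk i y j ∈ distTriang C) (X : C) :
    bracket Z M * bracket L Y *
        Nat.card {u : L ⟶ Y // p ≫ u = y ∧ u ∈ homWithCone L Y (X⟦(1 : ℤ)⟧)} =
      bracket M Y * bracket Z L' *
        Nat.card {v : Z ⟶ L' // v ≫ i = m ∧ v ∈ homWithCone Z L' X} := by
  have hmp : m ≫ p = 0 := comp_distTriang_mor_zero₁₂ _ h₁
  have hiy : i ≫ y = 0 := comp_distTriang_mor_zero₁₂ _ h₂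
  by_cases hmy : m ≫ y = 0
  swap
  · have : IsEmpty {u : L ⟶ Y // p ≫ u = y ∧ u ∈ homWithCone L Y (X⟦(1 : ℤ)⟧)} :=
      ⟨fun u => hmy (by rw [← u.2.1, reassoc_of% hmp, zero_comp])⟩
    have : IsEmpty {v : Z ⟶ L' // v ≫ i = m ∧ v ∈ homWithCone Z L' X} :=
      ⟨fun v => hmy (by rw [← v.2.1, Category.assoc, hiy, comp_zero])⟩
    simp
  obtain ⟨u₀, w₀, hu₀, hw₀, huw⟩ := exists_compatible h₁ h₂ hmy
  have hpq : p ≫ q = 0 := comp_distTriang_mor_zero₂₃ _ h₁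
  have hji : j ≫ i⟦(1 : ℤ)⟧' = 0 := comp_distTriang_mor_zero₃₁ _ h₂
  let S := shiftFunctor C (1 : ℤ)
  let ψ₁ := Preadditive.leftComp Y q
  let ψ₂ := Preadditive.rightComp (Z⟦(1 : ℤ)⟧) j
  have hN : Nat.card {g : Z⟦(1 : ℤ)⟧ ⟶ Y // u₀ + ψ₁ g ∈ homWithCone L Y (X⟦(1 : ℤ)⟧)} =
      Nat.card {g : Z⟦(1 : ℤ)⟧ ⟶ Y // S.preimage (w₀ + ψ₂ g) ∈ homWithCone Z L' X} := by
    refine Nat.card_congr (Equiv.subtypeEquivRight fun g => ?_)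
    obtain ⟨Cu, a, b, h₃⟩ := distinguished_cocone_triangle (u₀ + ψ₁ g)
    obtain ⟨Cv, c, d, h₄⟩ := distinguished_cocone_triangle (S.preimage (w₀ + ψ₂ g))
    have hu : p ≫ (u₀ + ψ₁ g) = y := by
      change p ≫ (u₀ + q ≫ g) = y
      rw [Preadditive.comp_add, reassoc_of% hpq, zero_comp, add_zero, hu₀]
    have hv : S.preimage (w₀ + ψ₂ g) ≫ i = m := by
      apply S.map_injective
      rw [Functor.map_comp, Functor.map_preimage]
      change (w₀ + g ≫ j) ≫ i⟦(1 : ℤ)⟧' = m⟦(1 : ℤ)⟧'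
      rw [Preadditive.add_comp, Category.assoc, hji, comp_zero, add_zero, hw₀]
    have huv : (u₀ + ψ₁ g) ≫ j = q ≫ S.map (S.preimage (w₀ + ψ₂ g)) := by
      rw [Functor.map_preimage]
      change (u₀ + q ≫ g) ≫ j = q ≫ (w₀ + g ≫ j)
      rw [Preadditive.comp_add, Preadditive.add_comp, huw, Category.assoc]
    obtain ⟨e⟩ := nonempty_iso_cone_of_compatible hloc h₁ h₂ hu hv huv h₃ h₄
    rw [mem_homWithCone_iff h₃, mem_homWithCone_iff h₄]
    exact ⟨fun ⟨e'⟩ => ⟨S.preimageIso (e.symm ≪≫ e')⟩, fun ⟨e'⟩ => ⟨e ≪≫ S.mapIso e'⟩⟩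
  have hU : Nat.card {u : L ⟶ Y // p ≫ u = y ∧ u ∈ homWithCone L Y (X⟦(1 : ℤ)⟧)} =
      Nat.card {u : L ⟶ Y // u - u₀ ∈ ψ₁.range ∧ u ∈ homWithCone L Y (X⟦(1 : ℤ)⟧)} := by
    refine Nat.card_congr (Equiv.subtypeEquivRight fun u => and_congr_left fun _ => ⟨?_, ?_⟩)
    · intro hu
      obtain ⟨g, hg⟩ := Triangle.yoneda_exact₃ _ h₁ (u - u₀)
        (show p ≫ (u - u₀) = 0 by rw [Preadditive.comp_sub, hu, hu₀, sub_self])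
      exact ⟨g, hg.symm⟩
    · rintro ⟨g, hg⟩
      have hg : q ≫ g = u - u₀ := hg
      rw [← sub_add_cancel u u₀, ← hg, Preadditive.comp_add, reassoc_of% hpq, zero_comp,
        zero_add, hu₀]
  have hV : Nat.card {v : Z ⟶ L' // v ≫ i = m ∧ v ∈ homWithCone Z L' X} =
      Nat.card {w : Z⟦(1 : ℤ)⟧ ⟶ L'⟦(1 : ℤ)⟧ //
        w - w₀ ∈ ψ₂.range ∧ S.preimage w ∈ homWithCone Z L' X} := by
    refine Nat.card_congr ((Functor.FullyFaithful.ofFullyFaithful S).homEquiv.subtypeEquiv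
      fun v => and_congr ⟨?_, ?_⟩ ?_)
    · intro hv
      obtain ⟨g, hg⟩ := Triangle.coyoneda_exact₁ _ h₂ (S.map v - w₀)
        (show (S.map v - w₀) ≫ i⟦(1 : ℤ)⟧' = 0 by
          rw [Preadditive.sub_comp, hw₀, ← hv, Functor.map_comp, sub_self])
      exact ⟨g, hg.symm⟩
    · rintro ⟨g, hg⟩
      have hg : g ≫ j = S.map v - w₀ := hg
      apply S.map_injective
      rw [Functor.map_comp, ← sub_add_cancel (S.map v) w₀, ← hg]
      change (g ≫ j + w₀) ≫ i⟦(1 : ℤ)⟧' = m⟦(1 : ℤ)⟧'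
      rw [Preadditive.add_comp, Category.assoc, hji, comp_zero, zero_add, hw₀]
    · simp [Functor.FullyFaithful.homEquiv]
  have c₁ := card_subtype_add_apply ψ₁ u₀ (· ∈ homWithCone L Y (X⟦(1 : ℤ)⟧))
  have c₂ := card_subtype_add_apply ψ₂ w₀ (S.preimage · ∈ homWithCone Z L' X)
  rw [← hU] at c₁
  rw [← hV, ← hN, c₁] at c₂
  have k₁ := card_ker_mul_card_range ψ₁
  have k₂ := card_ker_mul_card_range ψ₂
  have b₁ : (Nat.card ψ₁.range : ℚ) * bracket Z Y * bracket L Y = bracket M Y :=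
    card_range_leftComp_mul_bracket hvan _ h₁ Y
  have b₂ : (Nat.card ψ₂.range : ℚ) * bracket Z L' * bracket Z Y = bracket Z M :=
    card_range_rightComp_mul_bracket hvan _ h₂ Z
  generalize Nat.card {u : L ⟶ Y // p ≫ u = y ∧ u ∈ homWithCone L Y (X⟦(1 : ℤ)⟧)} = U at *
  generalize Nat.card {v : Z ⟶ L' // v ≫ i = m ∧ v ∈ homWithCone Z L' X} = V at *
  -- Both counts over `g` agree, `|ker ψ₁| U = |ker ψ₂| V`, while kernel times range is `|Hom(Z[1],
  -- Y)|` on either side.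
  have key : Nat.card ψ₂.range * U = Nat.card ψ₁.range * V := by
    refine Nat.eq_of_mul_eq_mul_left (Nat.mul_pos (Nat.card_pos (α := ψ₁.ker))
      (Nat.card_pos (α := ψ₂.ker))) ?_
    calc _ = (Nat.card ψ₂.ker * Nat.card ψ₂.range) * (Nat.card ψ₁.ker * U) := by ring
      _ = (Nat.card ψ₁.ker * Nat.card ψ₁.range) * (Nat.card ψ₂.ker * V) := by rw [k₁, k₂, c₂]
      _ = _ := by ring
  have key' : (Nat.card ψ₂.range : ℚ) * U = Nat.card ψ₁.range * V := mod_cast key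
  rw [← b₁, ← b₂]
  linear_combination bracket Z L' * bracket Z Y * bracket L Y * key'

theorem finsum_card_fiber_mul {S I : Type*} [Fintype S] (cl : S → I) (φ : I → ℚ) :
    ∑ᶠ ℓ, (Nat.card {s // cl s = ℓ} : ℚ) * φ ℓ = ∑ s, φ (cl s) := by
  classical
  rw [Finset.sum_comp φ cl, finsum_eq_sum_of_support_subset (s := Finset.univ.image cl)]
  · refine Finset.sum_congr rfl fun ℓ _ => ?_
    rw [nsmul_eq_mul, Nat.card_eq_fintype_card, Fintype.card_subtype]
  · intro ℓ hℓ
    have : Nat.card {s // cl s = ℓ} ≠ 0 := fun h => hℓ (by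
      simp only [h, Nat.cast_zero, zero_mul])
    obtain ⟨⟨s, hs⟩⟩ := (Nat.card_ne_zero.1 this).1
    simp only [Finset.coe_image, Finset.coe_univ, Set.image_univ]
    exact ⟨s, hs⟩

theorem isoClass_eq_iff {X : C} {ℓ : IsoClass C} : isoClass X = ℓ ↔ Nonempty (X ≅ ℓ.out) := by
  conv_lhs => rw [← Quotient.out_eq ℓ]
  exact Quotient.eq

theorem card_eq_sum_card_fiber {S T : Type*} [Finite S] [Fintype T] (F : S → T) (P : S → Prop) :
    Nat.card {s // P s} = ∑ t, Nat.card {s // F s = t ∧ P s} := by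
  rw [← Nat.card_congr (Equiv.sigmaFiberEquiv fun s : {s // P s} => F s), Nat.card_sigma]
  refine Finset.sum_congr rfl fun t _ => Nat.card_congr ?_
  exact (Equiv.subtypeSubtypeEquivSubtypeInter P (fun s => F s = t)).trans
    (Equiv.subtypeEquivRight fun s => and_comm)

include hloc hvan in
theorem finsum_hallNumber_mul_hallNumber [IsTriangulated C] (X Y Z M : C) :
    ∑ᶠ ℓ : IsoClass C, hallNumber X Y ℓ.out * hallNumber Z ℓ.out M =
      ∑ᶠ ℓ : IsoClass C, hallNumber Z X ℓ.out * hallNumber ℓ.out Y M := by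
  have := Fintype.ofFinite (Z ⟶ M)
  have := Fintype.ofFinite (M ⟶ Y)
  choose L p q h₁ using fun m : Z ⟶ M => distinguished_cocone_triangle m
  choose L' i j h₂ using fun y : M ⟶ Y => distinguished_cocone_triangle₁ y
  set D : ℚ := (Nat.card (Aut Y) * bracket Y Y) * (Nat.card (Aut Z) * bracket Z Z)
  have lhs : ∑ᶠ ℓ : IsoClass C, hallNumber X Y ℓ.out * hallNumber Z ℓ.out M =
      ∑ m : Z ⟶ M, ∑ y : M ⟶ Y, bracket Z M * bracket (L m) Y * Nat.card {u : L m ⟶ Y //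
        p m ≫ u = y ∧ u ∈ homWithCone (L m) Y (X⟦(1 : ℤ)⟧)} / D := by
    have hℓ (ℓ : IsoClass C) : hallNumber X Y ℓ.out * hallNumber Z ℓ.out M =
        (Nat.card {m : Z ⟶ M // isoClass (L m) = ℓ} : ℚ) * (bracket Z M * bracket ℓ.out Y *
          Nat.card (homWithCone ℓ.out Y (X⟦(1 : ℤ)⟧)) / D) := by
      rw [hallNumber_eq_homWithCone_shift hloc hvan X, hallNumber_eq_homWithCone hloc hvan Z]
      have : Nat.card (homWithCone Z M ℓ.out) =
          Nat.card {m : Z ⟶ M // isoClass (L m) = ℓ} :=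
        Nat.card_congr (Equiv.subtypeEquivRight fun m =>
          (mem_homWithCone_iff (h₁ m)).trans isoClass_eq_iff.symm)
      rw [this, div_mul_div_comm, mul_div_assoc']
      congr 1
      ring
    rw [finsum_congr hℓ, finsum_card_fiber_mul]
    refine Finset.sum_congr rfl fun m _ => ?_
    obtain ⟨e⟩ := isoClass_eq_iff.1 (rfl : isoClass (L m) = isoClass (L m))
    rw [← bracket_congr e (Iso.refl Y), ← card_homWithCone_congr e (Iso.refl Y) (Iso.refl _),
      ← Finset.sum_div, ← Finset.mul_sum, ← Nat.cast_sum]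
    congr 3
    -- The morphisms `u` are sorted by the composite `y = pu`.
    exact card_eq_sum_card_fiber (p m ≫ ·) _
  have rhs : ∑ᶠ ℓ : IsoClass C, hallNumber Z X ℓ.out * hallNumber ℓ.out Y M =
      ∑ y : M ⟶ Y, ∑ m : Z ⟶ M, bracket M Y * bracket Z (L' y) * Nat.card {v : Z ⟶ L' y //
        v ≫ i y = m ∧ v ∈ homWithCone Z (L' y) X} / D := by
    have hℓ (ℓ : IsoClass C) : hallNumber Z X ℓ.out * hallNumber ℓ.out Y M =
        (Nat.card {y : M ⟶ Y // isoClass (L' y) = ℓ} : ℚ) * (bracket M Y * bracket Z ℓ.out *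
          Nat.card (homWithCone Z ℓ.out X) / D) := by
      rw [hallNumber_eq_homWithCone_shift hloc hvan _ Y, hallNumber_eq_homWithCone hloc hvan Z]
      have : Nat.card (homWithCone M Y (ℓ.out⟦(1 : ℤ)⟧)) =
          Nat.card {y : M ⟶ Y // isoClass (L' y) = ℓ} :=
        Nat.card_congr (Equiv.subtypeEquivRight fun y =>
          (mem_homWithCone_shift_iff_nonempty_iso (h₂ y)).trans isoClass_eq_iff.symm)
      rw [this, div_mul_div_comm, mul_div_assoc', mul_comm (_ * bracket Z Z)]
      congr 1
      ring
    rw [finsum_congr hℓ, finsum_card_fiber_mul]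
    refine Finset.sum_congr rfl fun y _ => ?_
    obtain ⟨e⟩ := isoClass_eq_iff.1 (rfl : isoClass (L' y) = isoClass (L' y))
    rw [← bracket_congr (Iso.refl Z) e, ← card_homWithCone_congr (Iso.refl Z) e (Iso.refl _),
      ← Finset.sum_div, ← Finset.mul_sum, ← Nat.cast_sum]
    congr 3
    exact card_eq_sum_card_fiber (· ≫ i y) _
  rw [lhs, rhs, Finset.sum_comm]
  refine Finset.sum_congr rfl fun y _ => Finset.sum_congr rfl fun m _ => ?_
  rw [bracket_mul_card_fiber_eq hloc hvan (h₁ m) (h₂ y) X]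

end Associativity

/-! ### The unit -/

section Unit

variable {C : Type u} [Category.{v} C] [Preadditive C] [HasZeroObject C] [HasShift C ℤ]
  [∀ n : ℤ, (shiftFunctor C n).Additive] [Pretriangulated C]

theorem bracket_eq_one_of_isZero_left {X Y : C} (hX : IsZero X) : bracket X Y = 1 := by
  rw [bracket_eq_prod (N := 0)]
  · simp
  · intro i _
    exact ⟨((shiftFunctor C (i : ℤ)).map_isZero hX).eq_of_src⟩

theorem bracket_eq_one_of_isZero_right {X Y : C} (hY : IsZero Y) : bracket X Y = 1 := by
  rw [bracket_eq_prod (N := 0)]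
  · simp
  · intro i _
    exact ⟨hY.eq_of_tgt⟩

theorem card_aut_eq_one_of_isZero {X : C} (hX : IsZero X) : Nat.card (Aut X) = 1 := by
  have : Subsingleton (Aut X) := ⟨fun a b => Iso.ext (hX.eq_of_src _ _)⟩
  exact Nat.card_unique

variable [∀ X Y : C, Finite (X ⟶ Y)]
  (hloc : ∀ X : C, Indecomposable X → IsLocalRing (End X))
  (hvan : ∀ X Y : C, ∃ N : ℕ, ∀ i : ℕ, N < i → Subsingleton (X⟦(i : ℤ)⟧ ⟶ Y))
include hloc hvan

open Classical in
-- The only morphism `L → 0` has cocone `L`, and every bracket and automorphism count involved is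
-- `1`.
theorem hallNumber_zero_right (X L : C) :
    hallNumber X 0 L = if Nonempty (L ≅ X) then 1 else 0 := by
  have h : (0 : L ⟶ (0 : C)) ∈ homWithCone L 0 (X⟦(1 : ℤ)⟧) ↔ Nonempty (L ≅ X) :=
    mem_homWithCone_shift_iff_nonempty_iso (contractible_distinguished L)
  have hs : Subsingleton (homWithCone L (0 : C) (X⟦(1 : ℤ)⟧)) :=
    ⟨fun a b => Subtype.ext ((isZero_zero C).eq_of_tgt _ _)⟩
  rw [hallNumber_eq_homWithCone_shift hloc hvan, bracket_eq_one_of_isZero_right (isZero_zero C),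
    bracket_eq_one_of_isZero_right (isZero_zero C), card_aut_eq_one_of_isZero (isZero_zero C)]
  split_ifs with hL
  · have : Nonempty (homWithCone L (0 : C) (X⟦(1 : ℤ)⟧)) := ⟨⟨0, h.2 hL⟩⟩
    rw [Nat.card_unique]
    simp
  · have : IsEmpty (homWithCone L (0 : C) (X⟦(1 : ℤ)⟧)) :=
      ⟨fun a => hL (h.1 ((isZero_zero C).eq_of_tgt a.1 0 ▸ a.2))⟩
    simp

open Classical in
theorem hallNumber_zero_left (Y L : C) :
    hallNumber 0 Y L = if Nonempty (L ≅ Y) then 1 else 0 := by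
  have h : (0 : (0 : C) ⟶ L) ∈ homWithCone 0 L Y ↔ Nonempty (L ≅ Y) :=
    mem_homWithCone_iff (contractible_distinguished₁ L)
  have hs : Subsingleton (homWithCone (0 : C) L Y) :=
    ⟨fun a b => Subtype.ext ((isZero_zero C).eq_of_src _ _)⟩
  rw [hallNumber_eq_homWithCone hloc hvan, bracket_eq_one_of_isZero_left (isZero_zero C),
    bracket_eq_one_of_isZero_left (isZero_zero C), card_aut_eq_one_of_isZero (isZero_zero C)]
  split_ifs with hL
  · have : Nonempty (homWithCone (0 : C) L Y) := ⟨⟨0, h.2 hL⟩⟩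
    rw [Nat.card_unique]
    simp
  · have : IsEmpty (homWithCone (0 : C) L Y) :=
      ⟨fun a => hL (h.1 ((isZero_zero C).eq_of_src a.1 0 ▸ a.2))⟩
    simp

end Unit

/-! ### From structure constants to the algebra -/

section Algebra

open Classical in
/-- Structure constants that satisfy the associativity and unit laws define an algebra. -/
theorem exists_algebra_of_structureConstants {I : Type u} (c : I → I → I → ℚ)
    (hfin : ∀ i j, {k | c i j k ≠ 0}.Finite) (e : I)
    (hassoc : ∀ i j k m, ∑ᶠ l, c i j l * c l k m = ∑ᶠ l, c j k l * c i l m)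
    (hleft : ∀ j k, c e j k = if k = j then 1 else 0)
    (hright : ∀ i k, c i e k = if k = i then 1 else 0) :
    ∃ (H : Type u) (_ : Ring H) (_ : Algebra ℚ H) (b : Module.Basis I ℚ H),
      b e = 1 ∧ ∀ i j, b i * b j = ∑ᶠ k, c i j k • b k := by
  let V := I →₀ ℚ
  let b : Module.Basis I ℚ V := Finsupp.basisSingleOne
  have hc (i j : I) (x : I → V) :
      ∑ᶠ k, c i j k • x k = ∑ k ∈ (hfin i j).toFinset, c i j k • x k :=
    finsum_eq_sum_of_support_subset _ fun k hk => by
      simpa using fun h : c i j k = 0 => hk (by simp [h])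
  have hc' (i j : I) (x : I → ℚ) :
      ∑ᶠ k, c i j k * x k = ∑ k ∈ (hfin i j).toFinset, c i j k * x k :=
    finsum_eq_sum_of_support_subset _ fun k hk => by
      simpa using fun h : c i j k = 0 => hk (by simp [h])
  let μ : V →ₗ[ℚ] V →ₗ[ℚ] V := b.constr ℚ fun i => b.constr ℚ fun j => ∑ᶠ k, c i j k • b k
  have hμ (i j : I) : μ (b i) (b j) = ∑ᶠ k, c i j k • b k := by simp [μ]
  have hrepr (i j m : I) : b.repr (∑ᶠ k, c i j k • b k) m = c i j m := by
    rw [hc, map_sum, Finsupp.finsetSum_apply]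
    simp +contextual [Finsupp.single_apply, eq_comm]
  -- Associativity as an equality of trilinear maps, checked on coordinates of basis vectors.
  have h_assoc : μ.compr₂ μ = (LinearMap.llcomp ℚ V V V).compl₁₂ μ μ := by
    refine b.ext fun i => b.ext fun j => b.ext fun k => b.ext_elem fun m => ?_
    have h₁ : b.repr (μ (μ (b i) (b j)) (b k)) m = ∑ᶠ l, c i j l * c l k m := by
      rw [hμ, hc, map_sum, LinearMap.sum_apply, map_sum, Finsupp.finsetSum_apply, hc']
      simp [hμ, hrepr]
    have h₂ : b.repr (μ (b i) (μ (b j) (b k))) m = ∑ᶠ l, c j k l * c i l m := by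
      rw [hμ j k, hc, map_sum, map_sum, Finsupp.finsetSum_apply, hc']
      simp [hμ, hrepr]
    exact h₁.trans ((hassoc i j k m).trans h₂.symm)
  have h_one (i : I) : ∑ᶠ k, (if k = i then (1 : ℚ) else 0) • b k = b i := by
    rw [finsum_eq_single _ i fun k hk => by simp [hk]]
    simp
  have h_one_mul : μ (b e) = LinearMap.id := b.ext fun i => (hμ e i).trans (by
    simp only [hleft, h_one, LinearMap.id_apply])
  have h_mul_one : μ.flip (b e) = LinearMap.id := b.ext fun i => (hμ i e).trans (by
    simp only [hright, h_one, LinearMap.id_apply])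
  let R : Ring V :=
    { (inferInstance : AddCommGroup V) with
      mul := fun x y => μ x y
      one := b e
      mul_assoc := fun x y z => LinearMap.congr_fun (LinearMap.congr_fun₂ h_assoc x y) z
      one_mul := fun x => LinearMap.congr_fun h_one_mul x
      mul_one := fun x => LinearMap.congr_fun h_mul_one x
      left_distrib := fun x y z => map_add (μ x) y z
      right_distrib := fun x y z => LinearMap.map_add₂ μ x y z
      zero_mul := fun x => LinearMap.map_zero₂ μ x
      mul_zero := fun x => map_zero (μ x) }
  let A : @Algebra ℚ V _ R.toSemiring :=
    @Algebra.ofModule ℚ V _ R.toSemiring (inferInstanceAs (Module ℚ (I →₀ ℚ)))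
      (fun r x y => LinearMap.map_smul₂ μ r x y) (fun r x y => map_smul (μ x) r y)
  exact ⟨V, R, A, b, rfl, hμ⟩

end Algebra

/-- The terms of a convergent series tend to zero, and a natural number below `1` is `0`. -/
theorem exists_forall_subsingleton {k : Type w} [Field k] {C : Type u} [Category.{v} C]
    [Preadditive C] [Linear k C] [HasShift C ℤ]
    (hfin : ∀ X Y : C, Module.Finite k (X ⟶ Y))
    (hhom : ∀ X Y : C, Summable fun i : ℕ => Module.finrank k (X⟦(i : ℤ)⟧ ⟶ Y)) (X Y : C) :
    ∃ N : ℕ, ∀ i : ℕ, N < i → Subsingleton (X⟦(i : ℤ)⟧ ⟶ Y) := by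
  have h := ((hhom X Y).map (Nat.castAddMonoidHom ℝ)
    continuous_of_discreteTopology).tendsto_atTop_zero
  obtain ⟨N, hN⟩ := Filter.eventually_atTop.1 (h.eventually (gt_mem_nhds one_pos))
  refine ⟨N, fun i hi => ?_⟩
  have h₁ : ((Module.finrank k (X⟦(i : ℤ)⟧ ⟶ Y) : ℕ) : ℝ) < 1 := hN i hi.le
  have h₂ : Module.finrank k (X⟦(i : ℤ)⟧ ⟶ Y) < 1 := mod_cast h₁
  exact Module.finrank_zero_iff.1 (Nat.lt_one_iff.1 h₂)

end DerivedHall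

open DerivedHall in
theorem mainTheorem1
    {k : Type w} [Field k] [Finite k]
    {C : Type u} [Category.{v} C] [Preadditive C] [Linear k C] [HasZeroObject C]
    [HasShift C ℤ] [∀ n : ℤ, (shiftFunctor C n).Additive] [Pretriangulated C] [IsTriangulated C]
    -- Hom-finiteness
    (hfin : ∀ X Y : C, Module.Finite k (X ⟶ Y))
    -- indecomposable objects have local endomorphism rings
    (hloc : ∀ X : C, Indecomposable X → IsLocalRing (End X))
    -- left local homological finiteness
    (hhom : ∀ X Y : C, Summable fun i : ℕ => Module.finrank k (X⟦(i : ℤ)⟧ ⟶ Y)) :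
    -- the object `X₁` attached to a morphism `Y ⟶ X[1]` exists and is unique up to isomorphism
    (∀ (X Y : C) (h : Y ⟶ X⟦(1 : ℤ)⟧),
      (∃ A : C, IsIsoPart h A) ∧
        ∀ A B : C, IsIsoPart h A → IsIsoPart h B → Nonempty (A ≅ B)) ∧
    -- the other two expressions of the derived Hall number
    (∀ X Y L : C,
      hallNumber X Y L =
        Nat.card (homWithCone X L Y) * bracket X L / (Nat.card (Aut X) * bracket X X) ∧
      hallNumber X Y L =
        Nat.card (homWithCone L Y (X⟦(1 : ℤ)⟧)) * bracket L Y /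
          (Nat.card (Aut Y) * bracket Y Y)) ∧
    -- it depends only on isomorphism classes
    (∀ X X' Y Y' L L' : C, Nonempty (X ≅ X') → Nonempty (Y ≅ Y') → Nonempty (L ≅ L') →
      hallNumber X Y L = hallNumber X' Y' L') ∧
    -- the sum that defines the product is finite
    (∀ X Y : C, {ℓ : IsoClass C | hallNumber X Y ℓ.out ≠ 0}.Finite) ∧
    -- associativity in terms of the structure constants
    (∀ X Y Z M : C,
      ∑ᶠ ℓ : IsoClass C, hallNumber X Y ℓ.out * hallNumber Z ℓ.out M =
        ∑ᶠ ℓ : IsoClass C, hallNumber Z X ℓ.out * hallNumber ℓ.out Y M) ∧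
    -- the associative unital algebra with basis the isomorphism classes and unit `u_[0]`
    (∃ (H : Type u) (_ : Ring H) (_ : Algebra ℚ H) (b : Module.Basis (IsoClass C) ℚ H),
      b (isoClass (0 : C)) = 1 ∧
      ∀ X Y : C, b (isoClass X) * b (isoClass Y) =
        ∑ᶠ ℓ : IsoClass C, hallNumber X Y ℓ.out • b ℓ) := by
  classical
  have (X Y : C) : Finite (X ⟶ Y) := have := hfin X Y; Module.finite_of_finite k
  have hvan := exists_forall_subsingleton hfin hhom
  refine ⟨fun X Y h => ⟨?_, fun A B hA hB => ?_⟩, fun X Y L =>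
    ⟨hallNumber_eq_homWithCone hloc hvan X Y L, hallNumber_eq_homWithCone_shift hloc hvan X Y L⟩,
    fun X X' Y Y' L L' ⟨a⟩ ⟨c⟩ ⟨b⟩ => hallNumber_congr hloc hvan a c b,
    finite_setOf_hallNumber_ne_zero hloc hvan, finsum_hallNumber_mul_hallNumber hloc hvan, ?_⟩
  · obtain ⟨B, hB⟩ := exists_hasIsoPart h
    exact hB.exists_isIsoPart
  · obtain ⟨e⟩ := hA.hasIsoPart.nonempty_iso hloc hB.hasIsoPart
    exact ⟨(shiftFunctor C (1 : ℤ)).preimageIso e⟩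
  · have hout (X : C) : Nonempty (X ≅ (isoClass X).out) := isoClass_eq_iff.1 rfl
    have hunit (ℓ ℓ' : IsoClass C) : Nonempty (ℓ.out ≅ ℓ'.out) ↔ ℓ = ℓ' := by
      rw [← isoClass_eq_iff]
      exact (Quotient.out_eq ℓ).congr_left
    obtain ⟨e₀⟩ := hout 0
    obtain ⟨H, R, A, b, hb₁, hb₂⟩ := exists_algebra_of_structureConstants
      (fun ℓ₁ ℓ₂ ℓ : IsoClass C => hallNumber ℓ₁.out ℓ₂.out ℓ.out)
      (fun ℓ₁ ℓ₂ => finite_setOf_hallNumber_ne_zero hloc hvan ℓ₁.out ℓ₂.out) (isoClass 0)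
      (fun ℓ₁ ℓ₂ ℓ₃ ℓ => (finsum_hallNumber_mul_hallNumber hloc hvan _ _ _ _).symm)
      (fun ℓ₁ ℓ => by
        rw [← hallNumber_congr hloc hvan e₀ (Iso.refl _) (Iso.refl _),
          hallNumber_zero_left hloc hvan]
        simp [hunit])
      (fun ℓ₁ ℓ => by
        rw [← hallNumber_congr hloc hvan (Iso.refl _) e₀ (Iso.refl _),
          hallNumber_zero_right hloc hvan]
        simp [hunit])
    refine ⟨H, R, A, b, hb₁, fun X Y => (hb₂ _ _).trans (finsum_congr fun ℓ => ?_)⟩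
    obtain ⟨a⟩ := hout X
    obtain ⟨c⟩ := hout Y
    rw [hallNumber_congr hloc hvan a c (Iso.refl _)]
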